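/- A rooted map with $n$ edges is a connected multigraph with $n$ edges (loops and multiple edges are allowed), endowed with a cyclic ordering of the half-edges around each vertex and with a distinguished corner (a pair of consecutive half-edges at a vertex; an isolated vertex has one corner), considered up to isomorphism; the genus is arbitrary. A loop is an edge whose two half-edges belong to the same vertex. Define rational numbers $\eta_{k,\ell}$, $k,\ell\ge 0$, by $\eta_{0,0}=1$ and, for $k+\ell>0$, $$\eta_{k,\ell}=\frac{2k\,\eta_{k-1,\ell}+\ell\,\eta_{k+1,\ell-1}}{k+2\ell+\mathbf 1_{k>0}},$$ where $\eta$ is read as $0$ when an index is negative. Theorem. Let $Y_n$ be the number of loops in a uniformly random rooted map with $n$ edges. There is a probability measure $\mathcal L$ on $[0,1]$ such that $$\frac{Y_n}{n}\xrightarrow{\;d\;}\mathcal L\qquad(n\to\infty).$$ The law $\mathcal L$ is absolutely continuous with a computable density on $[0,1]$: it has a density $f$ with respect to Lebesgue measure for which there is an algorithm that, given $m\in\mathbb N$, outputs a step function $s_m$ with rational values on equal subintervals of $[0,1]$ such that $\int_0^1|f(x)-s_m(x)|\,dx\le 2^{-m}$. Its moments are $\int x^\ell\,d\mathcal L(x)=\eta_{0,\ell}$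 for all $\ell\ge 0$, and $\mathcal L$ is the only probability measure on $[0,1]$ with these moments. -/

import Mathlib

open MeasureTheory Filter Topology

/-- A rooted combinatorial map with `n` edges, of arbitrary genus, whose `2 n` half-edges carry
labels. The connected multigraph together with the cyclic orderings of half-edges around its
vertices is encoded by two permutations of the half-edges:
* `next` sends a half-edge to the following one around its vertex, so that the vertices are the
  cycles of `next` (fixed points included);
* `opp` sends a half-edge to the other half of its edge, so that the edges are the pairs
  `{h, opp h}`.

The corner between `h` and `next h` is identified with the half-edge `h`. The only map with a
further corner is the one with no edge: it has one vertex and one corner, which is written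
`none`. -/
@[ext]
structure LabelledRootedMap (n : ℕ) where
  next : Equiv.Perm (Fin (2 * n))
  opp : Equiv.Perm (Fin (2 * n))
  opp_opp : ∀ h, opp (opp h) = h
  opp_ne : ∀ h, opp h ≠ h
  /-- the underlying multigraph is connected -/
  connected : ∀ h h', ∃ g ∈ Subgroup.closure {next, opp}, g h = h'
  /-- the distinguished corner -/
  root : Option (Fin (2 * n))
  root_eq_none : root = none ↔ n = 0

namespace LabelledRootedMap

variable {n : ℕ}

/-- Isomorphism of rooted maps: a relabelling of the half-edges that preserves vertices, cyclic
orderings, edges and the root. -/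
def Iso (M M' : LabelledRootedMap n) : Prop :=
  ∃ e : Equiv.Perm (Fin (2 * n)),
    (∀ h, e (M.next h) = M'.next (e h)) ∧ (∀ h, e (M.opp h) = M'.opp (e h)) ∧
      M.root.map e = M'.root

theorem Iso.refl (M : LabelledRootedMap n) : Iso M M :=
  ⟨1, fun _ => rfl, fun _ => rfl, by cases M.root <;> rfl⟩

theorem Iso.symm {M M' : LabelledRootedMap n} (h : Iso M M') : Iso M' M := by
  obtain ⟨e, h1, h2, h3⟩ := h
  refine ⟨e.symm, fun x => ?_, fun x => ?_, ?_⟩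
  · rw [Equiv.symm_apply_eq, h1, Equiv.apply_symm_apply]
  · rw [Equiv.symm_apply_eq, h2, Equiv.apply_symm_apply]
  · rw [← h3]
    cases M.root <;> simp

theorem Iso.trans {M M' M'' : LabelledRootedMap n} (h : Iso M M') (h' : Iso M' M'') :
    Iso M M'' := by
  obtain ⟨e, h1, h2, h3⟩ := h
  obtain ⟨e', h1', h2', h3'⟩ := h'
  refine ⟨e.trans e', fun x => ?_, fun x => ?_, ?_⟩
  · simp [h1, h1']
  · simp [h2, h2']
  · rw [← h3', ← h3]
    cases M.root <;> simp

instance setoid (n : ℕ) : Setoid (LabelledRootedMap n) :=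
  ⟨Iso, Iso.refl, Iso.symm, Iso.trans⟩

/-- The set of loops: the edges `{h, opp h}` whose two half-edges belong to the same vertex. -/
def loops (M : LabelledRootedMap n) : Set (Sym2 (Fin (2 * n))) :=
  {e | ∃ h, e = s(h, M.opp h) ∧ M.next.SameCycle h (M.opp h)}

theorem loops_iso {M M' : LabelledRootedMap n} (h : Iso M M') :
    M.loops.ncard ≤ M'.loops.ncard := by
  obtain ⟨e, h1, h2, -⟩ := h
  refine Set.ncard_le_ncard_of_injOn (Sym2.map e) ?_
    ((Sym2.map.injective e.injective).injOn) (Set.toFinite _)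
  rintro _ ⟨x, rfl, hx⟩
  refine ⟨e x, by simp [h2], ?_⟩
  have hc : M'.next = e * M.next * e⁻¹ := by
    ext y
    simp [h1]
  rw [← h2, hc]
  simpa [Equiv.Perm.sameCycle_conj] using hx

instance : Finite (LabelledRootedMap n) :=
  Finite.of_injective
    (fun M : LabelledRootedMap n => (M.next, M.opp, M.root))
    (fun M M' h => by
      simp only [Prod.mk.injEq] at h
      exact LabelledRootedMap.ext h.1 h.2.1 h.2.2)

/-- There is a map with any given number of edges: here all half-edges are at one vertex. -/
instance : Nonempty (LabelledRootedMap n) := by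
  refine ⟨⟨finRotate (2 * n), Fin.revPerm, fun h => by simp, fun h he => ?_, fun h h' => ?_,
    if hn : 0 < n then some ⟨0, by omega⟩ else none, ?_⟩⟩
  · have := congrArg Fin.val he
    simp only [Fin.revPerm_apply, Fin.val_rev] at this
    omega
  · have hn : 2 ≤ 2 * n := by have := h.2; omega
    have hc := isCycle_finRotate_of_le hn
    have hs : ∀ x, finRotate (2 * n) x ≠ x := fun x => by
      have : x ∈ (finRotate (2 * n)).support := by
        rw [support_finRotate_of_le hn]; exact Finset.mem_univ x
      exact Equiv.Perm.mem_support.1 this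
    obtain ⟨i, hi⟩ := hc.sameCycle (hs h) (hs h')
    exact ⟨_, Subgroup.zpow_mem _ (Subgroup.subset_closure (Set.mem_insert _ _)) i, hi⟩
  · by_cases hn : 0 < n
    · simp [hn]; omega
    · simp [hn]; omega

end LabelledRootedMap

/-- Rooted maps with `n` edges, of arbitrary genus: half-edges are unlabelled, so that maps are
considered up to isomorphism. -/
def RootedMap (n : ℕ) : Type := Quotient (LabelledRootedMap.setoid n)

namespace RootedMap

variable {n : ℕ}

/-- The number of loops of a rooted map. -/
noncomputable def numLoops : RootedMap n → ℕ :=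
  Quotient.lift (fun M : LabelledRootedMap n => M.loops.ncard) fun _ _ h =>
    le_antisymm (LabelledRootedMap.loops_iso h)
      (LabelledRootedMap.loops_iso (LabelledRootedMap.Iso.symm h))

instance : Finite (RootedMap n) :=
  inferInstanceAs (Finite (Quotient (LabelledRootedMap.setoid n)))

instance : Nonempty (RootedMap n) :=
  (inferInstance : Nonempty (LabelledRootedMap n)).map (Quotient.mk _)

instance : MeasurableSpace (RootedMap n) := ⊤

instance : DiscreteMeasurableSpace (RootedMap n) := ⟨fun _ => trivial⟩

/-- The law of a random rooted map with `n` edges: all rooted maps with `n` edges are equally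
likely. -/
noncomputable def uniform (n : ℕ) : Measure (RootedMap n) :=
  ProbabilityTheory.uniformOn Set.univ

instance : IsProbabilityMeasure (uniform n) :=
  ProbabilityTheory.isProbabilityMeasure_uniformOn Set.finite_univ Set.univ_nonempty

end RootedMap

/-- The triangular array `η k ℓ`, normalised by `η 0 0 = 1`; `loopEta_rec` is its recurrence. -/
def loopEta : ℕ → ℕ → ℚ
  | 0, 0 => 1
  | k + 1, 0 => 2 * (k + 1) * loopEta k 0 / (k + 2)
  | 0, l + 1 => (l + 1) * loopEta 1 l / (2 * (l + 1))
  | k + 1, l + 1 =>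
      (2 * (k + 1) * loopEta k (l + 1) + (l + 1) * loopEta (k + 2) l) / (k + 1 + 2 * (l + 1) + 1)
termination_by k l => (l, k)

/-- The recurrence of the array. Where `k - 1` or `l - 1` is truncated, its factor vanishes. -/
theorem loopEta_rec (k l : ℕ) (h : 0 < k + l) :
    loopEta k l = (2 * k * loopEta (k - 1) l + l * loopEta (k + 1) (l - 1)) /
      (k + 2 * l + if 0 < k then 1 else 0) := by
  rcases k with _ | k <;> rcases l with _ | l
  · simp at h
  · simp [loopEta]
  · rw [loopEta]; push_cast; simp; ring
  · rw [loopEta]; push_cast; simp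

/-- A computable density on `[0, 1]`: a nonnegative integrable function that is computable in the
sense of `L¹`. There is an algorithm which, given `m`, outputs a step function with rational values
on equal subintervals of `[0, 1]` whose `L¹` distance to `f` is at most `2 ^ (-m)`. Here `N m + 1`
is the number of subintervals and `a m j / (d m + 1)` is the value on the subinterval with
index `j`. -/
def IsComputableDensity (f : ℝ → ℝ) : Prop :=
  Measurable f ∧ (∀ x, 0 ≤ f x) ∧ IntegrableOn f (Set.Icc 0 1) ∧
    ∃ (N d : ℕ → ℕ) (a : ℕ → ℕ → ℕ), Computable N ∧ Computable d ∧ Computable₂ a ∧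
      ∀ m : ℕ,
        ∫ x in Set.Icc (0 : ℝ) 1,
          |f x - (a m ⌊((N m : ℝ) + 1) * x⌋₊ : ℝ) / ((d m : ℝ) + 1)| ≤ (1 / 2 : ℝ) ^ m

/-! Fix the pairing `opp` of the 2n half-edges and let `next` be a uniform permutation, ignoring
connectivity at first. An edge is a loop when its ends share a cycle. The probability that l given
edges are all loops does not depend on n: `card_constrainedPerms` computes it by tracing the cycle
of a marked point z, `loopMoment k l` being the probability that k given points lie in the cycle of
z while l given pairs each share a cycle.

Probabilities that depend only on l, once realised as the moments of a law on [0, 1], make the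
number of loops a mixture of binomials (n, x) with x drawn from that law
(`card_filter_card_loopEdges`). Averages of φ(loops/n) are then integrals of Bernstein polynomials
of φ and converge.

The law is that of the sum of squared lengths in uniform stick-breaking, the limit of normalised
cycle lengths. It is the fixed point of X = U² + (1 - U)² X', with U uniform and independent of X';
integration by parts in u gives the mixed moments E[U^k X^l] the recurrence of `loopMoment`
(`stickMoment_rec`, `integral_stickMoment`).

The fixed point equation also smooths: a bounded function whose integrals over all subintervals are
small has a small integral against the law (`abs_integral_loopLaw_le`). This yields absolute
continuity and, by duality, an explicit L¹ rate for step functions built from Bernstein weights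
(`integral_abs_density_sub_step_le`). The weights are rational combinations of the moments, hence
computable.

Finally, all but O(1/n) of the permutations are transitive together with a given pairing
(`card_not_pairTransitive_le`), and a rooted map with an edge has no automorphism, so that uniform
labelled maps may replace uniform rooted maps. -/

/-! ### The normalised array and its recurrence. -/

/-- The normalised array `loopEta k l / 2 ^ k`. -/
def loopMoment (k l : ℕ) : ℚ := loopEta k l / 2 ^ k

theorem loopMoment_zero_zero : loopMoment 0 0 = 1 := by simp [loopMoment, loopEta]

theorem loopMoment_zero_left (l : ℕ) : loopMoment 0 l = loopEta 0 l := by simp [loopMoment]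

/-- When nothing else has to lie in the cycle of the marked point, the mark can be moved to an end
of one pair; the partner becomes the single point required in its cycle. -/
theorem loopMoment_zero_succ (l : ℕ) : loopMoment 0 (l + 1) = loopMoment 1 l := by
  have : (l : ℚ) + 1 ≠ 0 := by positivity
  rw [loopMoment, loopMoment, loopEta]
  field_simp

/-- The recurrence of the array with all boundary cases put together. -/
theorem loopMoment_rec (k l : ℕ) :
    ((k : ℚ) + 2 * l + 1) * loopMoment k l = k * loopMoment (k - 1) l +
      2 * l * loopMoment (k + 1) (l - 1) + if k = 0 then loopMoment 0 l else 0 := by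
  rcases k with _ | k
  · rcases l with _ | l
    · simp
    · simp [loopMoment_zero_succ]; ring
  · have h := loopEta_rec (k + 1) l (by omega)
    have hp : ((k : ℚ) + 1 + 2 * l + 1) ≠ 0 := by positivity
    simp only [Nat.succ_pos, if_true, Nat.cast_add, Nat.cast_one, Nat.add_sub_cancel] at h
    rw [eq_div_iff hp] at h
    simp only [loopMoment, Nat.add_sub_cancel, Nat.succ_ne_zero, if_false, Nat.cast_add,
      Nat.cast_one, pow_succ]
    field_simp
    linear_combination h

/-! ### Inserting a fixed point into a cycle. -/

namespace Equiv.Perm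

variable {α : Type*}

/-- A relation that relates every point to its image relates all points of a cycle. -/
theorem SameCycle.rel_of_forall {σ : Perm α} {r : α → α → Prop} (hr : Equivalence r)
    (h : ∀ a, r a (σ a)) {a b : α} (hab : σ.SameCycle a b) : r a b := by
  obtain ⟨i, rfl⟩ := hab
  have hn : ∀ (n : ℕ) (c : α), r c ((σ ^ n) c) := by
    intro n c
    induction n with
    | zero => exact hr.refl c
    | succ n ih =>
      rw [pow_succ', mul_apply]
      exact hr.trans ih (h _)
  rcases i with n | n
  · simpa using hn n a
  · have := hn (n + 1) ((σ ^ (Int.negSucc n)) a)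
    rw [zpow_negSucc, ← mul_apply, mul_inv_cancel, one_apply] at this
    exact hr.symm (by simpa [zpow_negSucc] using this)

variable [DecidableEq α]

/-- Left multiplication by `swap z i` inserts the fixed point `z` just before `i` in the cycle of
`i`; the other points keep their cycles. -/
theorem sameCycle_swap_mul_of_ne {σ : Perm α} {z i a b : α} (hz : σ z = z) (ha : a ≠ z)
    (hb : b ≠ z) : (swap z i * σ).SameCycle a b ↔ σ.SameCycle a b := by
  by_cases hi : i = z
  · rw [hi, swap_self]
    exact Iff.rfl
  constructor
  · intro h
    -- `f` contracts the inserted point onto `i`, which turns each step of the new cycle into a step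
    -- of `σ` or a rest.
    let f : α → α := fun y => if y = z then i else y
    have := h.rel_of_forall (r := fun a b => σ.SameCycle (f a) (f b))
      ⟨fun _ => .refl _ _, fun h => h.symm, fun h h' => h.trans h'⟩ (fun a => by
        by_cases haz : a = z
        · subst haz; simp [f, hz, SameCycle.refl]
        · have hsz : σ a ≠ z := fun h' => haz (σ.injective (h'.trans hz.symm))
          by_cases hai : σ a = i
          · simp only [f, haz, if_false, mul_apply, hai, swap_apply_right, if_true]
            exact ⟨1, by simpa using hai⟩
          · simp only [f, haz, if_false, mul_apply, swap_apply_of_ne_of_ne hsz hai, hsz]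
            exact ⟨1, by simp⟩)
    simpa [f, ha, hb] using this
  · intro h
    refine h.rel_of_forall (r := fun a b => (swap z i * σ).SameCycle a b)
      ⟨fun _ => .refl _ _, fun h => h.symm, fun h h' => h.trans h'⟩ (fun a => ?_)
    by_cases haz : a = z
    · subst haz; rw [hz]
    · have hsz : σ a ≠ z := fun h' => haz (σ.injective (h'.trans hz.symm))
      by_cases hai : σ a = i
      -- The way from `a` to `i` now passes through `z`, hence two steps.
      · refine ⟨2, ?_⟩
        rw [zpow_ofNat, pow_two, mul_apply, mul_apply _ _ a, hai, swap_apply_right, mul_apply, hz,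
          swap_apply_left]
      · exact ⟨1, by simp [mul_apply, swap_apply_of_ne_of_ne hsz hai]⟩

theorem sameCycle_swap_mul_left {σ : Perm α} {z i b : α} (hz : σ z = z) (hi : i ≠ z)
    (hb : b ≠ z) : (swap z i * σ).SameCycle z b ↔ σ.SameCycle i b := by
  rw [← sameCycle_swap_mul_of_ne hz hi hb (i := i)]
  have : (swap z i * σ).SameCycle z i := ⟨1, by simp [hz]⟩
  exact ⟨fun h => this.symm.trans h, fun h => this.trans h⟩

end Equiv.Perm

/-! ### Counting permutations with prescribed cycle incidences. -/

section Count

open Equiv.Perm Finset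

variable {α : Type*} [DecidableEq α] [Fintype α]

/-- The permutations that move only points of `s`, for which every point `a` of `P` lies in the
cycle of `p a` and every point of `K` lies in the cycle of `z`. -/
noncomputable def constrainedPerms (p : α → α) (s : Finset α) (z : α) (K P : Finset α) :
    Finset (Equiv.Perm α) := by
  classical
  exact univ.filter fun σ => (∀ a ∉ s, σ a = a) ∧ (∀ a ∈ P, σ.SameCycle a (p a)) ∧
    ∀ a ∈ K, σ.SameCycle z a

theorem mem_constrainedPerms {p : α → α} {s : Finset α} {z : α} {K P : Finset α}
    {σ : Equiv.Perm α} : σ ∈ constrainedPerms p s z K P ↔ (∀ a ∉ s, σ a = a) ∧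
      (∀ a ∈ P, σ.SameCycle a (p a)) ∧ ∀ a ∈ K, σ.SameCycle z a := by
  simp [constrainedPerms]

/-- The permutations of `constrainedPerms` that map `z` to `i` correspond to constrained
permutations of `s.erase z`. -/
theorem card_constrainedPerms_fiber {p : α → α} {s : Finset α} {z i : α} {K P K' P' : Finset α}
    (hz : z ∈ s) (hi : i ∈ s)
    (h : ∀ σ : Equiv.Perm α, σ z = z →
      (((∀ a ∈ P, (Equiv.swap z i * σ).SameCycle a (p a)) ∧
        ∀ a ∈ K, (Equiv.swap z i * σ).SameCycle z a) ↔
      (∀ a ∈ P', σ.SameCycle a (p a)) ∧ ∀ a ∈ K', σ.SameCycle i a)) :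
    ((constrainedPerms p s z K P).filter fun σ => σ z = i).card =
      (constrainedPerms p (s.erase z) i K' P').card := by
  -- Multiplication by `swap z i` is an involution that exchanges "`z` goes to `i`" with "`z` is
  -- fixed".
  refine card_nbij' (fun σ => Equiv.swap z i * σ) (fun σ => Equiv.swap z i * σ) ?_ ?_ ?_ ?_
  · intro σ hσ
    simp only [coe_filter, Set.mem_ofPred_eq, mem_constrainedPerms] at hσ
    obtain ⟨⟨h1, h2⟩, h3⟩ := hσ
    have hzz : (Equiv.swap z i * σ) z = z := by simp [h3]
    have := (h (Equiv.swap z i * σ) hzz).1 (by simpa [← mul_assoc] using h2)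
    rw [mem_coe, mem_constrainedPerms]
    refine ⟨fun a ha => ?_, this⟩
    by_cases haz : a = z
    · rw [haz, hzz]
    · have has : a ∉ s := fun h' => ha (mem_erase.2 ⟨haz, h'⟩)
      rw [mul_apply, h1 a has]
      exact Equiv.swap_apply_of_ne_of_ne haz fun h' => has (h' ▸ hi)
  · intro σ hσ
    rw [mem_coe, mem_constrainedPerms] at hσ
    obtain ⟨h1, h2⟩ := hσ
    have hzz : σ z = z := h1 z (by simp)
    simp only [coe_filter, Set.mem_ofPred_eq, mem_constrainedPerms]
    refine ⟨⟨fun a ha => ?_, (h σ hzz).2 h2⟩, by simp [hzz]⟩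
    rw [mul_apply, h1 a (fun h' => ha (mem_of_mem_erase h'))]
    exact Equiv.swap_apply_of_ne_of_ne (fun h' => ha (h' ▸ hz)) fun h' => ha (h' ▸ hi)
  · intro σ _; simp [← mul_assoc]
  · intro σ _; simp [← mul_assoc]

/-- The number of constrained permutations, in terms of the array `loopMoment`. -/
theorem card_constrainedPerms {p : α → α} (hp : ∀ a, p (p a) = a) (hne : ∀ a, p a ≠ a) (N : ℕ) :
    ∀ (s : Finset α) (z : α) (K P : Finset α) (l : ℕ), s.card = N + 1 → z ∈ s → z ∉ K → z ∉ P →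
      K ⊆ s → P ⊆ s → Disjoint K P → (∀ a ∈ P, p a ∈ P) → P.card = 2 * l →
      ((constrainedPerms p s z K P).card : ℚ) = (N + 1).factorial * loopMoment K.card l := by
  induction N with
  | zero =>
    intro s z K P l hs hz hzK hzP hK hP _ _ hl
    obtain ⟨y, rfl⟩ := card_eq_one.1 hs
    obtain rfl := mem_singleton.1 hz
    have hK0 : K = ∅ := by
      rcases subset_singleton_iff.1 hK with h | h
      · exact h
      · simp [h] at hzK
    have hP0 : P = ∅ := by
      rcases subset_singleton_iff.1 hP with h | h
      · exact h
      · simp [h] at hzP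
    subst hK0 hP0
    have hl0 : l = 0 := by simpa using hl.symm
    have : constrainedPerms p {z} z ∅ ∅ = {1} := by
      ext σ
      simp only [mem_constrainedPerms, mem_singleton, notMem_empty, false_imp_iff, implies_true,
        and_true]
      refine ⟨fun h => ?_, fun h => by simp [h]⟩
      ext a
      by_cases ha : a = z
      · by_contra hc
        have h1 : σ a ≠ z := by rw [ha]; intro h'; exact hc (by rw [ha, h']; rfl)
        exact h1 (by have := h _ h1; rw [σ.injective this, ha])
      · exact h a ha
    simp [this, hl0, loopMoment_zero_zero]
  | succ N ih =>
    intro s z K P l hs hz hzK hzP hK hP hKP hpP hl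
    have hs' : (s.erase z).card = N + 1 := by rw [card_erase_of_mem hz, hs]; rfl
    have hpz : ∀ {a}, a ∈ P → p a ≠ z := fun ha h' => hzP (h' ▸ hpP _ ha)
    have hPz : ∀ {a}, a ∈ P → a ≠ z := fun ha h' => hzP (h' ▸ ha)
    have hKz : ∀ {a}, a ∈ K → a ≠ z := fun ha h' => hzK (h' ▸ ha)
    have hKe : K ⊆ s.erase z := fun a ha => mem_erase.2 ⟨hKz ha, hK ha⟩
    have hPe : P ⊆ s.erase z := fun a ha => mem_erase.2 ⟨hPz ha, hP ha⟩
    have hPiff : ∀ (σ : Equiv.Perm α) (i : α), σ z = z →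
        ((∀ a ∈ P, (Equiv.swap z i * σ).SameCycle a (p a)) ↔ ∀ a ∈ P, σ.SameCycle a (p a)) :=
      fun σ i hσ => forall₂_congr fun a ha => sameCycle_swap_mul_of_ne hσ (hPz ha) (hpz ha)
    have hKiff : ∀ (σ : Equiv.Perm α) (i : α), σ z = z → i ≠ z →
        ((∀ a ∈ K, (Equiv.swap z i * σ).SameCycle z a) ↔ ∀ a ∈ K, σ.SameCycle i a) :=
      fun σ i hσ hi => forall₂_congr fun a ha => sameCycle_swap_mul_left hσ hi (hKz ha)
    have hsum : (constrainedPerms p s z K P).card =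
        ∑ i ∈ s, ((constrainedPerms p s z K P).filter fun σ => σ z = i).card := by
      refine card_eq_sum_card_fiberwise fun σ hσ => ?_
      rw [mem_coe, mem_constrainedPerms] at hσ
      by_contra hc
      have := hσ.1 _ hc
      exact hc (by rw [σ.injective this]; exact hz)
    -- the image of `z` is a point of `K`
    have hcK : ∀ i ∈ K, (((constrainedPerms p s z K P).filter fun σ => σ z = i).card : ℚ) =
        (N + 1).factorial * loopMoment (K.card - 1) l := fun i hi => by
      rw [card_constrainedPerms_fiber (K' := K.erase i) (P' := P) hz (hK hi),
        ih (s.erase z) i (K.erase i) P l hs' (hKe hi) (by simp)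
          (fun h => disjoint_left.1 hKP hi h) ((erase_subset _ _).trans hKe) hPe
          (hKP.mono_left (erase_subset _ _)) hpP hl, card_erase_of_mem hi]
      intro σ hσ
      rw [hPiff σ i hσ, hKiff σ i hσ (hKz hi)]
      refine and_congr_right fun _ => ⟨fun h a ha => h a (mem_of_mem_erase ha), fun h a ha => ?_⟩
      by_cases hai : a = i
      · rw [hai]
      · exact h a (mem_erase.2 ⟨hai, ha⟩)
    -- the image of `z` is a point of `P`
    have hcard2 : ∀ i ∈ P, ((P.erase i).erase (p i)).card = 2 * (l - 1) := fun i hi => by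
      rw [card_erase_of_mem (mem_erase.2 ⟨hne i, hpP i hi⟩), card_erase_of_mem hi, hl]; omega
    have hclosed : ∀ i ∈ P, ∀ a ∈ (P.erase i).erase (p i), p a ∈ (P.erase i).erase (p i) :=
      fun i _ a ha => by
        simp only [mem_erase] at ha ⊢
        refine ⟨fun h => ha.2.1 ?_, fun h => ha.1 ?_, hpP a ha.2.2⟩
        · rw [← hp a, h, hp]
        · rw [← h, hp]
    have hcP : ∀ i ∈ P, (((constrainedPerms p s z K P).filter fun σ => σ z = i).card : ℚ) =
        (N + 1).factorial * loopMoment (K.card + 1) (l - 1) := fun i hi => by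
      have hpiK : p i ∉ K := fun h => disjoint_left.1 hKP h (hpP i hi)
      -- As `i` joins the cycle of `z`, its pair constraint now says that `p i` lies there too: the
      -- pair leaves `P` and `p i` enters `K`.
      rw [card_constrainedPerms_fiber (K' := insert (p i) K) (P' := (P.erase i).erase (p i))
        hz (hP hi), ih (s.erase z) i _ _ (l - 1) hs' (hPe hi) _ (by simp) _ _ _ (hclosed i hi)
          (hcard2 i hi), card_insert_of_notMem hpiK]
      · rw [mem_insert, not_or]
        exact ⟨(hne i).symm, fun h => disjoint_left.1 hKP h hi⟩
      · exact insert_subset (hPe (hpP i hi)) hKe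
      · exact ((erase_subset _ _).trans (erase_subset _ _)).trans hPe
      · rw [disjoint_insert_left]
        exact ⟨by simp, hKP.mono_right ((erase_subset _ _).trans (erase_subset _ _))⟩
      · intro σ hσ
        rw [hPiff σ i hσ, hKiff σ i hσ (hPz hi)]
        simp only [mem_insert, forall_eq_or_imp, mem_erase]
        constructor
        · exact fun h => ⟨fun a ha => h.1 a ha.2.2, h.1 i hi, h.2⟩
        · refine fun h => ⟨fun a ha => ?_, h.2.2⟩
          by_cases h1 : a = i
          · rw [h1]; exact h.2.1
          · by_cases h2 : a = p i
            · rw [h2, hp]; exact h.2.1.symm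
            · exact h.1 a ⟨h2, h1, ha⟩
    -- the image of `z` is unconstrained
    have hcR : ∀ i ∈ ((s.erase z) \ K) \ P,
        (((constrainedPerms p s z K P).filter fun σ => σ z = i).card : ℚ) =
        (N + 1).factorial * loopMoment K.card l := fun i hi => by
      simp only [Finset.mem_sdiff] at hi
      rw [card_constrainedPerms_fiber (K' := K) (P' := P) hz (mem_of_mem_erase hi.1.1),
        ih (s.erase z) i K P l hs' hi.1.1 hi.1.2 hi.2 hKe hPe hKP hpP hl]
      intro σ hσ
      rw [hPiff σ i hσ, hKiff σ i hσ (ne_of_mem_erase hi.1.1)]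
    -- `z` is a fixed point
    have hcz : (((constrainedPerms p s z K P).filter fun σ => σ z = z).card : ℚ) =
        (N + 1).factorial * if K.card = 0 then loopMoment 0 l else 0 := by
      by_cases hK0 : K = ∅
      · subst hK0
        have hiff : ∀ σ : Equiv.Perm α, Equiv.swap z z * σ = σ := fun σ => by
          rw [Equiv.swap_self]; rfl
        -- Splitting off `z` leaves no marked point. Without pairs any remaining point can be
        -- marked; otherwise an end `y` of a pair is marked and `p y` is its only required
        -- companion.
        rcases l with _ | l
        · have hP0 : P = ∅ := by simpa using hl
          subst hP0
          obtain ⟨y, hy⟩ := card_pos.1 (by omega : 0 < (s.erase z).card)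
          rw [card_constrainedPerms_fiber (K' := ∅) (P' := ∅) hz hz (by simp)]
          have := ih (s.erase z) y ∅ ∅ 0 hs' hy (by simp) (by simp) (by simp) (by simp) (by simp)
            (by simp) (by simp)
          simp only [card_empty, if_true] at this ⊢
          rw [← this]
          congr 2
          ext σ
          simp [mem_constrainedPerms]
        · obtain ⟨y, hy⟩ := card_pos.1 (by omega : 0 < P.card)
          rw [card_constrainedPerms_fiber (K' := ∅) (P' := P) hz hz
            (fun σ _ => by rw [hiff])]
          have := ih (s.erase z) y {p y} ((P.erase y).erase (p y)) l hs' (hPe hy)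
            (by simpa using (hne y).symm) (by simp) (by simpa using hPe (hpP y hy))
            (((erase_subset _ _).trans (erase_subset _ _)).trans hPe) (by simp) (hclosed y hy)
            (hcard2 y hy)
          simp only [card_empty, card_singleton, if_true, loopMoment_zero_succ] at this ⊢
          rw [← this]
          congr 2
          ext σ
          simp only [mem_constrainedPerms, mem_singleton, forall_eq, mem_erase, notMem_empty,
            false_imp_iff, implies_true, and_true]
          refine and_congr_right fun _ => ⟨fun h => ⟨fun a ha => h a ha.2.2, h y hy⟩,
            fun h a ha => ?_⟩
          by_cases h1 : a = y
          · rw [h1]; exact h.2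
          · by_cases h2 : a = p y
            · rw [h2, hp]; exact h.2.symm
            · exact h.1 a ⟨h2, h1, ha⟩
      · rw [if_neg (by simpa using hK0), mul_zero, Nat.cast_eq_zero, card_eq_zero,
          filter_eq_empty_iff]
        intro σ hσ hσz
        obtain ⟨a, ha⟩ := nonempty_iff_ne_empty.2 hK0
        rw [mem_constrainedPerms] at hσ
        exact hKz ha ((SameCycle.eq_of_left (hσ.2.2 a ha) hσz).symm)
    have hsplit : ∀ g : α → ℚ, ∑ i ∈ s, g i = g z + (∑ i ∈ K, g i + ∑ i ∈ P, g i +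
        ∑ i ∈ ((s.erase z) \ K) \ P, g i) := fun g => by
      rw [← add_sum_erase s g hz, ← sum_sdiff hKe, ← sum_sdiff (subset_sdiff.2 ⟨hPe, hKP.symm⟩)]
      ring
    have hcard : ((((s.erase z) \ K) \ P).card : ℚ) = N + 1 - K.card - 2 * l := by
      have h1 := card_sdiff_add_card_eq_card hKe
      have h2 := card_sdiff_add_card_eq_card (subset_sdiff.2 ⟨hPe, hKP.symm⟩)
      rw [hs'] at h1
      rw [hl] at h2
      have : (((s.erase z) \ K) \ P).card + 2 * l + K.card = N + 1 := by omega
      have := congrArg (Nat.cast : ℕ → ℚ) this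
      push_cast at this
      linarith
    rw [hsum, Nat.cast_sum, hsplit, hcz, sum_congr rfl hcK, sum_congr rfl hcP, sum_congr rfl hcR]
    simp only [sum_const, nsmul_eq_mul, hcard, hl]
    -- With k = `K.card` and m = `loopMoment`, the four classes must sum to (N + 2) m(k, l). The
    -- unconstrained class supplies (N + 1 - k - 2l) m(k, l), so N cancels and the recurrence
    -- remains.
    have hrec := loopMoment_rec K.card l
    rw [Nat.factorial_succ (N + 1)]
    push_cast
    linear_combination -((N + 1).factorial : ℚ) * hrec

/-- The number of permutations for which every point of `P` lies in the cycle of its partner. -/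
theorem card_perms_sameCycle_partner {p : α → α} (hp : ∀ a, p (p a) = a) (hne : ∀ a, p a ≠ a)
    (P : Finset α) (hpP : ∀ a ∈ P, p a ∈ P) (l : ℕ) (hl : P.card = 2 * l)
    (C : Finset (Equiv.Perm α)) (hC : ∀ σ, σ ∈ C ↔ ∀ a ∈ P, σ.SameCycle a (p a)) :
    (C.card : ℚ) = (Fintype.card α).factorial * loopMoment 0 l := by
  rcases l with _ | l
  · have hP0 : P = ∅ := by simpa using hl
    subst hP0
    have : C = univ := by ext; simp [hC]
    simp [this, loopMoment_zero_zero, Fintype.card_perm]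
  · obtain ⟨y, hy⟩ := card_pos.1 (by omega : 0 < P.card)
    obtain ⟨N, hN⟩ : ∃ N, Fintype.card α = N + 1 :=
      Nat.exists_eq_succ_of_ne_zero (Fintype.card_pos_iff.2 ⟨y⟩).ne'
    have hcl : ∀ a ∈ (P.erase y).erase (p y), p a ∈ (P.erase y).erase (p y) := fun a ha => by
      simp only [mem_erase] at ha ⊢
      refine ⟨fun h => ha.2.1 ?_, fun h => ha.1 ?_, hpP a ha.2.2⟩
      · rw [← hp a, h, hp]
      · rw [← h, hp]
    have := card_constrainedPerms hp hne N univ y {p y} ((P.erase y).erase (p y)) l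
      (by rw [card_univ, hN]) (mem_univ y) (by simpa using (hne y).symm) (by simp)
      (subset_univ _) (subset_univ _) (by simp) hcl (by
        rw [card_erase_of_mem (mem_erase.2 ⟨hne y, hpP y hy⟩), card_erase_of_mem hy, hl]; omega)
    rw [card_singleton, ← loopMoment_zero_succ, ← hN] at this
    rw [← this]
    congr 2
    ext σ
    simp only [hC, mem_constrainedPerms, mem_singleton, forall_eq, mem_erase, mem_univ,
      not_true_eq_false, false_imp_iff, implies_true, true_and]
    refine ⟨fun h => ⟨fun a ha => h a ha.2.2, h y hy⟩, fun h a ha => ?_⟩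
    by_cases h1 : a = y
    · rw [h1]; exact h.2
    · by_cases h2 : a = p y
      · rw [h2, hp]; exact h.2.symm
      · exact h.1 a ⟨h2, h1, ha⟩

end Count

/-! ### The number of loops over all permutations. -/

section LoopEdges

open Finset

variable {α : Type*} [DecidableEq α] [Fintype α]

/-- The edges `{h, p h}` of a pairing `p` of half-edges. -/
def pairEdges (p : α → α) : Finset (Sym2 α) := univ.image fun h => s(h, p h)

/-- The edges `{h, p h}` both of whose half-edges lie in one cycle of `σ`. -/
noncomputable def loopEdges (p : α → α) (σ : Equiv.Perm α) : Finset (Sym2 α) := by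
  classical
  exact (univ.filter fun h => σ.SameCycle h (p h)).image fun h => s(h, p h)

/-- The half-edges of a set of edges. -/
def halfEdges (p : α → α) (T : Finset (Sym2 α)) : Finset α := univ.filter fun h => s(h, p h) ∈ T

theorem mem_halfEdges {p : α → α} {T : Finset (Sym2 α)} {h : α} :
    h ∈ halfEdges p T ↔ s(h, p h) ∈ T := by simp [halfEdges]

theorem loopEdges_subset (p : α → α) (σ : Equiv.Perm α) : loopEdges p σ ⊆ pairEdges p :=
  image_subset_image (subset_univ _)

variable {p : α → α} (hp : ∀ a, p (p a) = a) (hne : ∀ a, p a ≠ a)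
include hp

omit [DecidableEq α] [Fintype α] in
theorem sym2_partner_eq_iff {a b : α} : s(a, p a) = s(b, p b) ↔ a = b ∨ a = p b := by
  rw [Sym2.eq_iff]
  constructor
  · rintro (h | h)
    exacts [.inl h.1, .inr h.1]
  · rintro (rfl | rfl)
    exacts [.inl ⟨rfl, rfl⟩, .inr ⟨rfl, hp b⟩]

theorem partner_mem_halfEdges {T : Finset (Sym2 α)} {h : α} (hh : h ∈ halfEdges p T) :
    p h ∈ halfEdges p T := by
  rw [mem_halfEdges] at hh ⊢
  rwa [(sym2_partner_eq_iff hp).2 (.inr rfl)]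

theorem subset_loopEdges_iff {T : Finset (Sym2 α)} (hT : T ⊆ pairEdges p) (σ : Equiv.Perm α) :
    T ⊆ loopEdges p σ ↔ ∀ h ∈ halfEdges p T, σ.SameCycle h (p h) := by
  constructor
  · intro h a ha
    obtain ⟨b, hb, hab⟩ := mem_image.1 (h (mem_halfEdges.1 ha))
    have hb := (mem_filter.1 hb).2
    rcases (sym2_partner_eq_iff hp).1 hab.symm with rfl | rfl
    · exact hb
    · rw [hp]; exact hb.symm
  · intro h e he
    obtain ⟨a, -, rfl⟩ := mem_image.1 (hT he)
    exact mem_image.2 ⟨a, mem_filter.2 ⟨mem_univ a, h a (mem_halfEdges.2 he)⟩, rfl⟩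

include hne

theorem card_halfEdges {T : Finset (Sym2 α)} (hT : T ⊆ pairEdges p) :
    (halfEdges p T).card = 2 * T.card := by
  rw [card_eq_sum_card_fiberwise (f := fun h => s(h, p h)) (t := T)
    (fun h hh => mem_halfEdges.1 hh), sum_const_nat (m := 2), mul_comm]
  intro e he
  obtain ⟨a, -, rfl⟩ := mem_image.1 (hT he)
  have : (halfEdges p T).filter (fun h => s(h, p h) = s(a, p a)) = {a, p a} := by
    ext h
    rw [mem_filter, sym2_partner_eq_iff hp, mem_insert, mem_singleton]
    refine ⟨fun h => h.2, fun h => ⟨?_, h⟩⟩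
    rw [mem_halfEdges, (sym2_partner_eq_iff hp).2 h]
    exact he
  rw [this, card_pair (hne a).symm]

theorem two_mul_card_pairEdges : 2 * (pairEdges p).card = Fintype.card α := by
  rw [← card_halfEdges hp hne subset_rfl, ← card_univ]
  congr 1
  ext h
  simpa [mem_halfEdges, pairEdges] using ⟨h, .inl ⟨rfl, rfl⟩⟩

/-- The generating function of the number of loops over all permutations. -/
theorem sum_pow_card_loopEdges (t : ℝ) :
    ∑ σ : Equiv.Perm α, t ^ (loopEdges p σ).card = (Fintype.card α).factorial *
      ∑ T ∈ (pairEdges p).powerset, (t - 1) ^ T.card * (loopMoment 0 T.card : ℝ) := by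
  classical
  -- Expanding ((t - 1) + 1)^m over subsets of the loop set reduces the sum to counting, for each
  -- `T`, the permutations that make all of `T` loops.
  have h1 : ∀ σ : Equiv.Perm α, t ^ (loopEdges p σ).card =
      ∑ T ∈ (pairEdges p).powerset, if T ⊆ loopEdges p σ then (t - 1) ^ T.card else 0 := by
    intro σ
    have := sum_pow_mul_eq_add_pow (t - 1) 1 (loopEdges p σ)
    rw [sub_add_cancel] at this
    rw [← this, ← sum_filter]
    simp only [one_pow, mul_one]
    refine sum_congr ?_ fun _ _ => rfl
    ext T
    simp only [mem_powerset, mem_filter]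
    exact ⟨fun h => ⟨h.trans (loopEdges_subset p σ), h⟩, fun h => h.2⟩
  simp_rw [h1]
  rw [sum_comm, mul_sum]
  refine sum_congr rfl fun T hT => ?_
  rw [← sum_filter, sum_const, nsmul_eq_mul]
  have hT := mem_powerset.1 hT
  have := card_perms_sameCycle_partner hp hne (halfEdges p T)
    (fun a ha => partner_mem_halfEdges hp ha) T.card (card_halfEdges hp hne hT)
    (univ.filter fun σ : Equiv.Perm α => T ⊆ loopEdges p σ)
    (fun σ => by simp [subset_loopEdges_iff hp hT])
  have := congrArg (Rat.cast : ℚ → ℝ) this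
  push_cast at this
  rw [this]
  ring

/-- Over all permutations, the number of loops is a mixture of binomial distributions, the mixing
measure having the moments `loopMoment 0`. -/
theorem card_filter_card_loopEdges {n : ℕ} (hn : Fintype.card α = 2 * n) (μ : Measure ℝ)
    [IsProbabilityMeasure μ] (hμ : μ (Set.Icc 0 1)ᶜ = 0)
    (hmom : ∀ l : ℕ, ∫ x, x ^ l ∂μ = (loopMoment 0 l : ℝ)) (j : ℕ) :
    ((univ.filter fun σ : Equiv.Perm α => (loopEdges p σ).card = j).card : ℝ) =
      (2 * n).factorial * ∫ x, (n.choose j : ℝ) * x ^ j * (1 - x) ^ (n - j) ∂μ := by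
  have hcard : (pairEdges p).card = n := by
    have := two_mul_card_pairEdges hp hne
    omega
  have hint : ∀ g : ℝ → ℝ, Continuous g → Integrable g μ := by
    intro g hg
    have hμ' : μ.restrict (Set.Icc 0 1) = μ :=
      Measure.restrict_eq_self_of_ae_mem (by rw [ae_iff]; exact hμ)
    rw [← hμ']
    exact hg.continuousOn.integrableOn_compact isCompact_Icc
  have hI : ∀ t : ℝ, ∑ σ : Equiv.Perm α, t ^ (loopEdges p σ).card =
      ∑ i ∈ range (n + 1), ((2 * n).factorial *
        ∫ x, (n.choose i : ℝ) * x ^ i * (1 - x) ^ (n - i) ∂μ) * t ^ i := by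
    intro t
    rw [sum_pow_card_loopEdges hp hne, hn]
    -- With moments written as integrals, the sum over subsets is the expansion of (1 + (t - 1)x)^n,
    -- the generating function of the binomial law (n, x).
    have e1 : ∑ T ∈ (pairEdges p).powerset, (t - 1) ^ T.card * (loopMoment 0 T.card : ℝ) =
        ∫ x, ((t - 1) * x + 1) ^ n ∂μ := by
      simp_rw [← hmom, ← integral_const_mul]
      rw [← integral_finsetSum _ fun T _ => hint _ (by fun_prop)]
      refine integral_congr_ae (.of_forall fun x => ?_)
      have := sum_pow_mul_eq_add_pow ((t - 1) * x) 1 (pairEdges p)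
      rw [hcard] at this
      simp only [← this, one_pow, mul_one, mul_pow]
    rw [e1]
    have e2 : ∀ x : ℝ, ((t - 1) * x + 1) ^ n =
        ∑ i ∈ range (n + 1), (n.choose i : ℝ) * x ^ i * (1 - x) ^ (n - i) * t ^ i := fun x => by
      rw [show (t - 1) * x + 1 = t * x + (1 - x) by ring, add_pow]
      exact sum_congr rfl fun i _ => by rw [mul_pow]; ring
    simp_rw [e2]
    rw [integral_finsetSum _ fun T _ => hint _ (by fun_prop), mul_sum]
    exact sum_congr rfl fun i _ => by rw [integral_mul_const]; ring
  -- Equality at every real t is equality of polynomials, so coefficients can be compared.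
  have hpoly : ∑ σ : Equiv.Perm α, (Polynomial.X : Polynomial ℝ) ^ (loopEdges p σ).card =
      ∑ i ∈ range (n + 1), Polynomial.C ((2 * n).factorial *
        ∫ x, (n.choose i : ℝ) * x ^ i * (1 - x) ^ (n - i) ∂μ) * Polynomial.X ^ i := by
    refine Polynomial.funext fun t => ?_
    simpa [Polynomial.eval_finsetSum] using hI t
  have hco := congrArg (fun q => Polynomial.coeff q j) hpoly
  simp only [Polynomial.finsetSum_coeff, Polynomial.coeff_X_pow, Polynomial.coeff_C_mul,
    mul_ite, mul_one, mul_zero, sum_ite_eq, mem_range] at hco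
  rw [card_filter]
  push_cast
  simp_rw [eq_comm (b := j)]
  rw [hco]
  split_ifs with h
  · rfl
  · rw [Nat.choose_eq_zero_of_lt (by omega)]
    simp

/-- Averages over all permutations of a function of the number of loops. -/
theorem sum_comp_card_loopEdges {n : ℕ} (hn : Fintype.card α = 2 * n) (μ : Measure ℝ)
    [IsProbabilityMeasure μ] (hμ : μ (Set.Icc 0 1)ᶜ = 0)
    (hmom : ∀ l : ℕ, ∫ x, x ^ l ∂μ = (loopMoment 0 l : ℝ)) (φ : ℕ → ℝ) :
    ∑ σ : Equiv.Perm α, φ (loopEdges p σ).card = (2 * n).factorial *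
      ∑ j ∈ range (n + 1), φ j * ∫ x, (n.choose j : ℝ) * x ^ j * (1 - x) ^ (n - j) ∂μ := by
  have hcard : (pairEdges p).card = n := by
    have := two_mul_card_pairEdges hp hne
    omega
  rw [← sum_fiberwise_of_maps_to (s := univ) (t := range (n + 1))
    (g := fun σ : Equiv.Perm α => (loopEdges p σ).card), mul_sum]
  · refine sum_congr rfl fun j _ => ?_
    rw [sum_congr rfl (g := fun _ => φ j) (fun σ hσ => by rw [(mem_filter.1 hσ).2]), sum_const,
      nsmul_eq_mul, card_filter_card_loopEdges hp hne hn μ hμ hmom]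
    ring
  · intro σ _
    rw [mem_range, Nat.lt_succ_iff, ← hcard]
    exact card_le_card (loopEdges_subset p σ)

end LoopEdges

/-! ### The stick-breaking law and its fixed point equation. -/

section StickBreaking

open unitInterval

/-- Prepending an independent variable to a sequence of independent identically distributed
variables gives a sequence of the same law. -/
theorem map_cons_prod_infinitePi {X : Type*} [MeasurableSpace X] (μ : Measure X)
    [IsProbabilityMeasure μ] :
    (μ.prod (Measure.infinitePi fun _ : ℕ => μ)).map
      (fun p : X × (ℕ → X) => (fun i => Nat.casesOn i p.1 p.2 : ℕ → X)) =
      Measure.infinitePi fun _ : ℕ => μ := by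
  classical
  have hmeas : Measurable (fun p : X × (ℕ → X) => (fun i => Nat.casesOn i p.1 p.2 : ℕ → X)) := by
    refine measurable_pi_lambda _ fun i => ?_
    rcases i with _ | i
    · exact measurable_fst
    · exact (measurable_pi_apply i).comp measurable_snd
  refine Measure.eq_infinitePi _ fun s t ht => ?_
  obtain ⟨N, hN⟩ : ∃ N, s ⊆ Finset.range (N + 1) :=
    ⟨s.sup id, fun i hi => Finset.mem_range.2 (Nat.lt_succ_iff.2 (Finset.le_sup (f := id) hi))⟩
  -- Padding by `univ` makes the box depend on an initial segment of indices, from which the factor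
  -- at 0 splits off.
  let t' : ℕ → Set X := fun i => if i ∈ s then t i else Set.univ
  have ht' : ∀ i, MeasurableSet (t' i) := fun i => by
    by_cases h : i ∈ s
    · simp only [t', h, if_true]; exact ht i
    · simp only [t', h, if_false]; exact MeasurableSet.univ
  have hprod : ∏ i ∈ s, μ (t i) = ∏ i ∈ Finset.range (N + 1), μ (t' i) := by
    rw [← Finset.prod_subset hN (fun i _ hi => by simp [t', hi])]
    exact Finset.prod_congr rfl fun i hi => by simp [t', hi]
  have hset : (fun p : X × (ℕ → X) => (fun i => Nat.casesOn i p.1 p.2 : ℕ → X)) ⁻¹'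
      (Set.pi s t) = t' 0 ×ˢ Set.pi (Finset.range N) fun i => t' (i + 1) := by
    ext ⟨x, ω⟩
    simp only [Set.mem_preimage, Set.mem_pi, Finset.mem_coe, Set.mem_prod, Finset.mem_range]
    constructor
    · intro h
      refine ⟨?_, fun i _ => ?_⟩
      · by_cases h0 : 0 ∈ s
        · simpa [t', h0] using h 0 h0
        · simp [t', h0]
      · by_cases h0 : i + 1 ∈ s
        · simpa [t', h0] using h (i + 1) h0
        · simp [t', h0]
    · rintro ⟨h0, h1⟩ i hi
      rcases i with _ | i
      · simpa [t', hi] using h0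
      · have := h1 i (by have := Finset.mem_range.1 (hN hi); omega)
        simpa [t', hi] using this
  rw [Measure.map_apply hmeas (MeasurableSet.pi s.countable_toSet fun i _ => ht i), hset,
    Measure.prod_prod, Measure.infinitePi_pi _ (fun i _ => ht' (i + 1)), hprod,
    Finset.prod_range_succ', mul_comm]

/-- The `i`-th squared length of the stick-breaking construction. -/
def stickSq (ω : ℕ → I) (i : ℕ) : ℝ :=
  (ω i : ℝ) ^ 2 * ∏ j ∈ Finset.range i, (1 - (ω j : ℝ)) ^ 2

/-- The sum of the squared lengths of the stick-breaking construction. -/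
noncomputable def stickSum (ω : ℕ → I) : ℝ := ∑' i, stickSq ω i

theorem stickSq_nonneg (ω : ℕ → I) (i : ℕ) : 0 ≤ stickSq ω i :=
  mul_nonneg (sq_nonneg _) (Finset.prod_nonneg fun _ _ => sq_nonneg _)

theorem sum_stickSq_le (ω : ℕ → I) (n : ℕ) : ∑ i ∈ Finset.range n, stickSq ω i ≤ 1 := by
  -- Keeping the squared length of the remaining stick makes the induction close, since u² + (1 -
  -- u)² ≤ 1.
  have h : ∑ i ∈ Finset.range n, stickSq ω i ≤ 1 - ∏ j ∈ Finset.range n, (1 - (ω j : ℝ)) ^ 2 := by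
    induction n with
    | zero => simp
    | succ n ih =>
      rw [Finset.sum_range_succ, Finset.prod_range_succ, stickSq]
      have h0 := (ω n).2.1
      have h1 := (ω n).2.2
      have hP : 0 ≤ ∏ j ∈ Finset.range n, (1 - (ω j : ℝ)) ^ 2 :=
        Finset.prod_nonneg fun _ _ => sq_nonneg _
      nlinarith [mul_nonneg hP (mul_nonneg h0 (sub_nonneg.2 h1))]
  have hP : 0 ≤ ∏ j ∈ Finset.range n, (1 - (ω j : ℝ)) ^ 2 :=
    Finset.prod_nonneg fun _ _ => sq_nonneg _
  linarith

theorem summable_stickSq (ω : ℕ → I) : Summable (stickSq ω) :=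
  summable_of_sum_range_le (stickSq_nonneg ω) (sum_stickSq_le ω)

theorem stickSum_nonneg (ω : ℕ → I) : 0 ≤ stickSum ω := tsum_nonneg (stickSq_nonneg ω)

theorem stickSum_le_one (ω : ℕ → I) : stickSum ω ≤ 1 :=
  Real.tsum_le_of_sum_range_le (stickSq_nonneg ω) (sum_stickSq_le ω)

theorem measurable_stickSum : Measurable stickSum := by
  have hm : ∀ i, Measurable fun ω => stickSq ω i := fun i => by
    unfold stickSq
    fun_prop
  refine measurable_of_tendsto_metrizable (f := fun n ω => ∑ i ∈ Finset.range n, stickSq ω i)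
    (fun n => by fun_prop) ?_
  rw [tendsto_pi_nhds]
  exact fun ω => (summable_stickSq ω).hasSum.tendsto_sum_nat

/-- The squared-length sum after one more stick is broken off. -/
def stickMap (q u : ℝ) : ℝ := u ^ 2 + (1 - u) ^ 2 * q

theorem stickMap_mem {q u : ℝ} (hq : q ∈ Set.Icc (0 : ℝ) 1) (hu : u ∈ Set.Icc (0 : ℝ) 1) :
    stickMap q u ∈ Set.Icc (0 : ℝ) 1 := by
  obtain ⟨h0, h1⟩ := hq
  obtain ⟨h2, h3⟩ := hu
  refine ⟨by unfold stickMap; positivity, ?_⟩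
  unfold stickMap
  nlinarith [mul_nonneg (sq_nonneg (1 - u)) (sub_nonneg.2 h1), mul_nonneg h2 (sub_nonneg.2 h3)]

/-- After the first break, the same construction runs on a stick of length 1 - u, so its squares
scale by (1 - u)². -/
theorem stickSum_cons (u : I) (ω : ℕ → I) :
    stickSum (fun i => Nat.casesOn i u ω) = stickMap (stickSum ω) u := by
  rw [stickSum, (summable_stickSq _).tsum_eq_zero_add]
  have : ∀ i, stickSq (fun i => Nat.casesOn i u ω) (i + 1) = (1 - (u : ℝ)) ^ 2 * stickSq ω i := by
    intro i
    simp only [stickSq, Finset.prod_range_succ']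
    exact (mul_assoc _ _ _).symm.trans (mul_comm _ _)
  simp_rw [this, tsum_mul_left]
  simp [stickSq, stickMap, stickSum]

/-- The law of the sum of the squared lengths of the stick-breaking construction. -/
noncomputable def loopLaw : Measure ℝ :=
  (Measure.infinitePi fun _ : ℕ => (volume : Measure I)).map stickSum

instance : IsProbabilityMeasure loopLaw :=
  Measure.isProbabilityMeasure_map measurable_stickSum.aemeasurable

theorem loopLaw_compl_Icc : loopLaw (Set.Icc (0 : ℝ) 1)ᶜ = 0 := by
  rw [loopLaw, Measure.map_apply measurable_stickSum measurableSet_Icc.compl]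
  have : stickSum ⁻¹' (Set.Icc (0 : ℝ) 1)ᶜ = ∅ := by
    ext ω
    simpa using And.intro (stickSum_nonneg ω) (stickSum_le_one ω)
  rw [this, measure_empty]

theorem ae_loopLaw_mem_Icc : ∀ᵐ q ∂loopLaw, q ∈ Set.Icc (0 : ℝ) 1 := by
  rw [ae_iff]; exact loopLaw_compl_Icc

theorem measurable_stickMap : Measurable fun p : ℝ × ℝ => stickMap p.1 p.2 := by
  unfold stickMap
  fun_prop

/-- The fixed point equation of the law. -/
theorem map_stickMap_loopLaw :
    (loopLaw.prod (volume.restrict (Set.Icc (0 : ℝ) 1))).map (fun p => stickMap p.1 p.2) =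
      loopLaw := by
  have hI : (volume : Measure I).map Subtype.val = volume.restrict (Set.Icc (0 : ℝ) 1) :=
    (map_comap_subtype_coe measurableSet_Icc volume)
  set P := Measure.infinitePi fun _ : ℕ => (volume : Measure I) with hP
  have hcons : Measurable (fun p : I × (ℕ → I) => (fun i => Nat.casesOn i p.1 p.2 : ℕ → I)) := by
    refine measurable_pi_lambda _ fun i => ?_
    rcases i with _ | i
    · exact measurable_fst
    · exact (measurable_pi_apply i).comp measurable_snd
  have h1 : loopLaw.prod (volume.restrict (Set.Icc (0 : ℝ) 1)) =
      (P.prod (volume : Measure I)).map (Prod.map stickSum Subtype.val) := by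
    rw [← hI, loopLaw, Measure.map_prod_map _ _ measurable_stickSum measurable_subtype_coe]
  rw [h1, Measure.map_map measurable_stickMap (by
    exact measurable_stickSum.prodMap measurable_subtype_coe), ← Measure.prod_swap,
    Measure.map_map (by
      exact measurable_stickMap.comp (measurable_stickSum.prodMap measurable_subtype_coe))
      measurable_swap]
  conv_rhs => rw [loopLaw, ← map_cons_prod_infinitePi, Measure.map_map measurable_stickSum hcons]
  congr 1
  ext ⟨u, ω⟩
  exact (stickSum_cons u ω).symm

/-- The form in which the fixed point equation is used, both for the moments and for the smoothing
estimate. -/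
theorem integral_loopLaw {φ : ℝ → ℝ} (hφ : Measurable φ) {B : ℝ}
    (hB : ∀ x ∈ Set.Icc (0 : ℝ) 1, |φ x| ≤ B) :
    ∫ x, φ x ∂loopLaw = ∫ q, (∫ u in (0 : ℝ)..1, φ (stickMap q u)) ∂loopLaw := by
  have hae : ∀ᵐ p ∂loopLaw.prod (volume.restrict (Set.Icc (0 : ℝ) 1)),
      p.1 ∈ Set.Icc (0 : ℝ) 1 ∧ p.2 ∈ Set.Icc (0 : ℝ) 1 := by
    refine (Measure.quasiMeasurePreserving_fst.ae ae_loopLaw_mem_Icc).and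
      (Measure.quasiMeasurePreserving_snd.ae ?_)
    exact ae_restrict_mem measurableSet_Icc
  conv_lhs => rw [← map_stickMap_loopLaw]
  rw [integral_map measurable_stickMap.aemeasurable hφ.aestronglyMeasurable, integral_prod]
  · refine integral_congr_ae (.of_forall fun q => ?_)
    simp only
    rw [intervalIntegral.integral_of_le zero_le_one, integral_Icc_eq_integral_Ioc]
  · refine Integrable.of_bound (hφ.comp measurable_stickMap).aestronglyMeasurable B ?_
    filter_upwards [hae] with p hp
    exact hB _ (stickMap_mem hp.1 hp.2)

end StickBreaking

/-! ### Moments of the law. -/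

section Moments

theorem integrable_of_continuous_of_compl_Icc {μ : Measure ℝ} [IsProbabilityMeasure μ]
    (hμ : μ (Set.Icc 0 1)ᶜ = 0) {g : ℝ → ℝ} (hg : Continuous g) : Integrable g μ := by
  have hμ' : μ.restrict (Set.Icc 0 1) = μ :=
    Measure.restrict_eq_self_of_ae_mem (by rw [ae_iff]; exact hμ)
  rw [← hμ']
  exact hg.continuousOn.integrableOn_compact isCompact_Icc

/-- The mixed moments of the broken-off stick and the sum of squares, conditionally on the
remainder. -/
noncomputable def stickMoment (k l : ℕ) (q : ℝ) : ℝ := ∫ u in (0 : ℝ)..1, u ^ k * stickMap q u ^ l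

theorem continuous_stickMoment (k l : ℕ) : Continuous (stickMoment k l) := by
  unfold stickMoment
  refine intervalIntegral.continuous_parametric_intervalIntegral_of_continuous' ?_ 0 1
  unfold stickMap
  fun_prop

/-- Integrate the derivative of (1 - u) u^k v^l over [0, 1], where v = `stickMap q u` satisfies (1 -
u) v' = 2u - 2v. The boundary term at u = 0 is q^l when k = 0 and vanishes otherwise. This is
`loopMoment_rec` with q^l in place of `loopMoment 0 l`. -/
theorem stickMoment_rec (k l : ℕ) (q : ℝ) :
    ((k : ℝ) + 2 * l + 1) * stickMoment k l q = k * stickMoment (k - 1) l q +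
      2 * l * stickMoment (k + 1) (l - 1) q + if k = 0 then q ^ l else 0 := by
  have hd : ∀ u : ℝ, HasDerivAt (fun u => (1 - u) * u ^ k * stickMap q u ^ l)
      (k * (u ^ (k - 1) * stickMap q u ^ l) + 2 * l * (u ^ (k + 1) * stickMap q u ^ (l - 1)) -
        ((k : ℝ) + 2 * l + 1) * (u ^ k * stickMap q u ^ l)) u := by
    intro u
    have h1 : HasDerivAt (fun u : ℝ => 1 - u) (-1) u := by
      simpa using (hasDerivAt_id u).const_sub 1
    have h2 : HasDerivAt (fun u : ℝ => u ^ k) (k * u ^ (k - 1)) u := by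
      simpa using hasDerivAt_pow k u
    have h3 : HasDerivAt (fun u : ℝ => stickMap q u) (2 * u - 2 * (1 - u) * q) u := by
      unfold stickMap
      have := ((hasDerivAt_id u).pow 2).add ((h1.pow 2).mul_const q)
      refine this.congr_deriv ?_
      simp only [id, Nat.cast_ofNat]
      ring
    have h4 := h3.pow l
    refine ((h1.mul h2).mul h4).congr_deriv ?_
    have hk : (k : ℝ) * u ^ (k - 1) * u = k * u ^ k := by
      rcases k with _ | k
      · simp
      · simp only [Nat.add_sub_cancel, pow_succ]; ring
    have hl : (l : ℝ) * stickMap q u ^ (l - 1) * stickMap q u = l * stickMap q u ^ l := by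
      rcases l with _ | l
      · simp
      · simp only [Nat.add_sub_cancel, pow_succ]; ring
    have hv : (1 - u) * (2 * u - 2 * (1 - u) * q) = 2 * u - 2 * stickMap q u := by
      unfold stickMap; ring
    simp only [Pi.mul_apply, Pi.pow_apply]
    linear_combination (-stickMap q u ^ l) * hk - 2 * u ^ k * hl +
      u ^ k * (l * stickMap q u ^ (l - 1)) * hv
  have hc : ∀ a b : ℕ, Continuous fun u : ℝ => u ^ a * stickMap q u ^ b := fun a b => by
    unfold stickMap; fun_prop
  have h := intervalIntegral.integral_eq_sub_of_hasDerivAt (a := 0) (b := 1) (fun u _ => hd u)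
    (by apply Continuous.intervalIntegrable; have := hc; fun_prop)
  have i : ∀ (a b : ℕ) (c : ℝ), IntervalIntegrable (fun u : ℝ => c * (u ^ a * stickMap q u ^ b))
    volume 0 1 := fun a b c => (continuous_const.mul (hc a b)).intervalIntegrable _ _
  rw [intervalIntegral.integral_sub ((i _ _ _).add (i _ _ _)) (i _ _ _),
    intervalIntegral.integral_add (i _ _ _) (i _ _ _)] at h
  simp only [intervalIntegral.integral_const_mul] at h
  simp only [stickMoment]
  have h0 : (1 - (0 : ℝ)) * 0 ^ k * stickMap q 0 ^ l = if k = 0 then q ^ l else 0 := by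
    rcases k with _ | k <;> simp [stickMap]
  rw [h0] at h
  simp only [sub_self, zero_mul] at h
  linarith

theorem integral_pow_loopLaw_eq (l : ℕ) :
    ∫ x, x ^ l ∂loopLaw = ∫ q, stickMoment 0 l q ∂loopLaw := by
  rw [integral_loopLaw (B := 1) (by fun_prop)]
  · simp [stickMoment]
  · intro x hx
    rw [abs_pow, abs_of_nonneg hx.1]
    exact pow_le_one₀ hx.1 hx.2

/-- Both neighbours in the recurrence have k + 2l smaller by one. For k = 0 the fixed point equation
identifies the boundary term with the unknown itself; one copy cancels and the factor 2l is left. -/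
theorem integral_stickMoment : ∀ (s k l : ℕ), k + 2 * l = s →
    ∫ q, stickMoment k l q ∂loopLaw = (loopMoment k l : ℝ) := by
  have hint : ∀ k l, Integrable (stickMoment k l) loopLaw := fun k l =>
    integrable_of_continuous_of_compl_Icc loopLaw_compl_Icc (continuous_stickMoment k l)
  have hrec : ∀ k l : ℕ, ((k : ℝ) + 2 * l + 1) * ∫ q, stickMoment k l q ∂loopLaw =
      k * ∫ q, stickMoment (k - 1) l q ∂loopLaw +
        2 * l * ∫ q, stickMoment (k + 1) (l - 1) q ∂loopLaw +
        if k = 0 then ∫ q, stickMoment 0 l q ∂loopLaw else 0 := by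
    intro k l
    rw [← integral_pow_loopLaw_eq, ← integral_const_mul]
    simp_rw [stickMoment_rec]
    have i1 := (hint (k - 1) l).const_mul (k : ℝ)
    have i2 := (hint (k + 1) (l - 1)).const_mul (2 * (l : ℝ))
    have i12 : Integrable (fun q => (k : ℝ) * stickMoment (k - 1) l q +
      2 * (l : ℝ) * stickMoment (k + 1) (l - 1) q) loopLaw := i1.add i2
    have i3 : Integrable (fun q : ℝ => if k = 0 then q ^ l else 0) loopLaw := by
      split_ifs
      · exact integrable_of_continuous_of_compl_Icc loopLaw_compl_Icc (by fun_prop)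
      · exact integrable_zero _ _ _
    rw [integral_add i12 i3, integral_add i1 i2, integral_const_mul, integral_const_mul]
    split_ifs <;> simp
  intro s
  induction s using Nat.strong_induction_on with
  | _ s ih =>
  intro k l hs
  have h1 := hrec k l
  have h2 := congrArg (Rat.cast : ℚ → ℝ) (loopMoment_rec k l)
  push_cast at h2
  rcases k with _ | k
  · rcases l with _ | l
    · simp [stickMoment, loopMoment_zero_zero]
    · have := ih (1 + 2 * l) (by omega) 1 l rfl
      simp only [Nat.add_sub_cancel, if_true, zero_add, Nat.cast_zero, zero_mul] at h1 h2
      rw [this] at h1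
      have hl : (2 * ((l + 1 : ℕ) : ℝ)) ≠ 0 := by positivity
      apply mul_left_cancel₀ hl
      linarith
  · have hp : (((k + 1 : ℕ) : ℝ) + 2 * l + 1) ≠ 0 := by positivity
    apply mul_left_cancel₀ hp
    rw [h1, h2]
    simp only [Nat.add_sub_cancel, Nat.succ_ne_zero, if_false]
    rw [ih (k + 2 * l) (by omega) k l rfl]
    rcases l with _ | l
    · simp
    · rw [Nat.add_sub_cancel, ih (k + 1 + 1 + 2 * l) (by omega) (k + 1 + 1) l rfl]
      simp

theorem integral_pow_loopLaw (l : ℕ) : ∫ x, x ^ l ∂loopLaw = (loopMoment 0 l : ℝ) := by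
  rw [integral_pow_loopLaw_eq, integral_stickMoment (0 + 2 * l) 0 l rfl]

end Moments

/-! ### Bernstein polynomials and determinacy of moments. -/

section Bernstein

/-- The Bernstein polynomials of a bounded continuous function integrate to its integral in the
limit. -/
theorem tendsto_sum_integral_bernstein (μ : Measure ℝ) [IsProbabilityMeasure μ]
    (hμ : μ (Set.Icc 0 1)ᶜ = 0) {φ : ℝ → ℝ} (hφ : Continuous φ) :
    Tendsto (fun n : ℕ => ∑ j ∈ Finset.range (n + 1), φ (j / n) *
      ∫ x, (n.choose j : ℝ) * x ^ j * (1 - x) ^ (n - j) ∂μ) atTop (𝓝 (∫ x, φ x ∂μ)) := by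
  let f : C(unitInterval, ℝ) := ⟨fun x => φ x, by fun_prop⟩
  have hB := bernsteinApproximation_uniform f
  rw [Metric.tendsto_atTop] at hB ⊢
  intro ε hε
  obtain ⟨N, hN⟩ := hB (ε / 2) (by positivity)
  refine ⟨N, fun n hn => ?_⟩
  have hint : ∀ g : ℝ → ℝ, Continuous g → Integrable g μ := fun g hg =>
    integrable_of_continuous_of_compl_Icc hμ hg
  simp_rw [← integral_const_mul]
  rw [← integral_finsetSum _ (fun j _ => hint _ (by fun_prop)), dist_eq_norm,
    ← integral_sub (hint _ (by fun_prop)) (hint _ hφ)]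
  refine lt_of_le_of_lt (norm_integral_le_of_norm_le_const (C := ε / 2) ?_) (by simp; linarith)
  have hae : ∀ᵐ x ∂μ, x ∈ Set.Icc (0 : ℝ) 1 := by rw [ae_iff]; exact hμ
  filter_upwards [hae] with x hx
  have h1 := (ContinuousMap.dist_apply_le_dist (f := bernsteinApproximation n f) (g := f)
    ⟨x, hx⟩).trans (hN n hn).le
  rw [dist_eq_norm, bernsteinApproximation.apply] at h1
  rw [Finset.sum_range]
  have h2 : ∑ j : Fin (n + 1), φ ((j : ℕ) / n) *
      ((n.choose j : ℝ) * x ^ (j : ℕ) * (1 - x) ^ (n - (j : ℕ))) =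
      ∑ k : Fin (n + 1), bernstein n k ⟨x, hx⟩ • f (bernstein.z k) := by
    refine Finset.sum_congr rfl fun j _ => ?_
    simp only [f, bernstein_apply, bernstein.z, ContinuousMap.coe_mk, smul_eq_mul]
    ring
  rw [h2]
  exact h1

/-- A probability measure on `[0, 1]` is determined by its moments. -/
theorem measure_eq_of_moments {μ ν : Measure ℝ} [IsProbabilityMeasure μ] [IsProbabilityMeasure ν]
    (hμ : μ (Set.Icc 0 1)ᶜ = 0) (hν : ν (Set.Icc 0 1)ᶜ = 0)
    (h : ∀ l : ℕ, ∫ x, x ^ l ∂μ = ∫ x, x ^ l ∂ν) : μ = ν := by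
  have hpoly : ∀ q : Polynomial ℝ, ∫ x, q.eval x ∂μ = ∫ x, q.eval x ∂ν := by
    intro q
    simp_rw [Polynomial.eval_eq_sum_range]
    rw [integral_finsetSum _ fun i _ =>
        integrable_of_continuous_of_compl_Icc hμ (by fun_prop),
      integral_finsetSum _ fun i _ =>
        integrable_of_continuous_of_compl_Icc hν (by fun_prop)]
    simp_rw [integral_const_mul, h]
  refine ext_of_forall_integral_eq_of_IsFiniteMeasure fun φ => ?_
  -- The approximating integrals involve only polynomials, hence agree for both measures, and they
  -- converge to the two integrals of φ.
  refine tendsto_nhds_unique (tendsto_sum_integral_bernstein μ hμ φ.continuous) ?_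
  refine (tendsto_sum_integral_bernstein ν hν φ.continuous).congr fun n =>
    Finset.sum_congr rfl fun j _ => ?_
  congr 1
  have := hpoly (Polynomial.C (n.choose j : ℝ) * Polynomial.X ^ j *
    (1 - Polynomial.X) ^ (n - j))
  simpa using this.symm

end Bernstein

/-! ### Smoothing by one break of the stick, and absolute continuity. -/

section Smoothing

/-- Substituting a parabola smooths an oscillating function. -/
theorem abs_integral_comp_parabola_le {χ : ℝ → ℝ} (hm : Measurable χ)
    (hM : ∀ x ∈ Set.Icc (0 : ℝ) 1, |χ x| ≤ 2) {ε : ℝ} (hε : 0 < ε)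
    (hχ : ∀ a b, 0 ≤ a → a ≤ b → b ≤ 1 → |∫ x in a..b, χ x| ≤ 2 * ε) {q b : ℝ}
    (hq : q ∈ Set.Icc (0 : ℝ) 1) (hb : b ∈ Set.Icc (0 : ℝ) 1) :
    |∫ w in (0 : ℝ)..b, χ ((q + w ^ 2) / (1 + q))| ≤ 4 * √ε := by
  obtain ⟨hq0, hq1⟩ := hq
  obtain ⟨hb0, hb1⟩ := hb
  set y : ℝ → ℝ := fun w => (q + w ^ 2) / (1 + q) with hy
  have hqp : 0 < 1 + q := by linarith
  have hymem : ∀ w, 0 ≤ w → w ≤ 1 → y w ∈ Set.Icc (0 : ℝ) 1 := fun w h0 h1 =>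
    ⟨by simp only [hy]; positivity, by
      simp only [hy]; rw [div_le_one hqp]; nlinarith⟩
  have hyc : Continuous y := by simp only [hy]; fun_prop
  have hym : Measurable fun w => χ (y w) := hm.comp hyc.measurable
  -- The substitution x = `y w` degenerates at w = 0. The trivial bound on [0, δ] costs 2δ and the
  -- substitution on [δ, b] costs 2ε/δ; δ = √ε balances them.
  set δ := √ε with hδ
  have hδ0 : 0 < δ := Real.sqrt_pos.2 hε
  have hδ2 : ε = δ * δ := (Real.mul_self_sqrt hε.le).symm
  have hint : ∀ c d, 0 ≤ c → c ≤ d → d ≤ 1 →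
      IntervalIntegrable (fun w => χ (y w)) volume c d := by
    intro c d h0 h1 h2
    rw [intervalIntegrable_iff_integrableOn_Ioc_of_le h1]
    refine Measure.integrableOn_of_bounded (M := 2) (by simp) hym.aestronglyMeasurable ?_
    filter_upwards [ae_restrict_mem measurableSet_Ioc] with w hw
    exact hM _ (hymem w (h0.trans hw.1.le) (hw.2.trans h2))
  have hsmall : ∀ c, 0 ≤ c → c ≤ 1 → |∫ w in (0 : ℝ)..c, χ (y w)| ≤ 2 * c := by
    intro c h0 h1
    have := intervalIntegral.norm_integral_le_of_norm_le_const (a := 0) (b := c) (C := 2)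
      (f := fun w => χ (y w)) (fun w hw => by
        rw [Set.uIoc_of_le h0] at hw
        exact hM _ (hymem w hw.1.le (hw.2.trans h1)))
    rwa [sub_zero, abs_of_nonneg h0] at this
  by_cases hbδ : b ≤ δ
  · have := hsmall b hb0 hb1
    linarith
  push Not at hbδ
  -- the substitution
  have hsub : ∀ w, δ ≤ w → w ≤ b → |∫ t in δ..w, χ (y t) * t| ≤ 2 * ε := by
    intro w h1 h2
    have h := integral_Icc_deriv_smul_of_deriv_nonneg (f := y) (f' := fun t => 2 * t / (1 + q))
      (g := χ) (a := δ) (b := w) hyc.continuousOn (fun t _ => by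
        have := ((hasDerivAt_pow 2 t).const_add q).div_const (1 + q)
        simpa using this) (fun t ht => by
        have : 0 ≤ t := hδ0.le.trans ht.1.le
        positivity) h1
    rw [integral_Icc_eq_integral_Ioc, integral_Icc_eq_integral_Ioc,
      ← intervalIntegral.integral_of_le h1] at h
    have hyw : y δ ≤ y w := by
      simp only [hy]
      gcongr
    rw [← intervalIntegral.integral_of_le hyw] at h
    have h3 : ∫ t in δ..w, χ (y t) * t = (1 + q) / 2 * ∫ x in (y δ)..(y w), χ x := by
      rw [← h, ← intervalIntegral.integral_const_mul]
      refine intervalIntegral.integral_congr fun t _ => ?_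
      simp only [smul_eq_mul]
      field_simp
    rw [h3, abs_mul, abs_of_pos (by positivity)]
    have h4 := hχ (y δ) (y w) (hymem δ hδ0.le (hbδ.le.trans hb1)).1 hyw
      (hymem w (hδ0.le.trans h1) (h2.trans hb1)).2
    have h5 : 0 ≤ |∫ x in (y δ)..(y w), χ x| := abs_nonneg _
    nlinarith
  have hgint : IntervalIntegrable (fun t => χ (y t) * t) volume δ b :=
    (hint δ b hδ0.le hbδ.le hb1).mul_continuousOn continuousOn_id
  -- Integration by parts against w⁻¹ removes the factor t. As χ is only measurable, the primitive
  -- is absolutely continuous and differentiable almost everywhere.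
  have hgac := hgint.absolutelyContinuousOnInterval_intervalIntegral (c := δ) (by simp)
  have hne : ∀ w ∈ Set.uIcc δ b, w ≠ 0 := fun w hw => by
    rw [Set.uIcc_of_le hbδ.le] at hw
    exact (hδ0.trans_le hw.1).ne'
  have hfac : AbsolutelyContinuousOnInterval (fun w : ℝ => w⁻¹) δ b :=
    ContDiffOn.absolutelyContinuousOnInterval (contDiffOn_id.inv hne)
  have hparts := hfac.integral_mul_deriv_eq_deriv_mul hgac
  have hlhs : ∫ w in δ..b, w⁻¹ * deriv (fun w => ∫ t in δ..w, χ (y t) * t) w =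
      ∫ w in δ..b, χ (y w) := by
    refine intervalIntegral.integral_congr_ae ?_
    filter_upwards [hgint.ae_hasDerivAt_integral] with w hw hwm
    have hwm' := Set.uIoc_subset_uIcc hwm
    rw [(hw hwm' δ (by simp)).deriv]
    field_simp [hne w hwm']
  rw [hlhs] at hparts
  have hderiv : ∀ w : ℝ, deriv (fun w : ℝ => w⁻¹) w = -(w ^ 2)⁻¹ := fun w => by simp
  have hinv : ∫ w in δ..b, (w ^ 2)⁻¹ = δ⁻¹ - b⁻¹ := by
    have := intervalIntegral.integral_eq_sub_of_hasDerivAt (a := δ) (b := b)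
      (f := fun w : ℝ => -w⁻¹) (f' := fun w => (w ^ 2)⁻¹) (fun w hw => by
        exact ((hasDerivAt_inv (hne w hw)).fun_neg).congr_deriv (neg_neg _)) (by
        refine ContinuousOn.intervalIntegrable fun w hw => ?_
        exact (ContinuousAt.inv₀ (continuous_pow 2).continuousAt (pow_ne_zero 2 (hne w hw))).continuousWithinAt)
    rw [this]; ring
  have hrest : |∫ w in δ..b, deriv (fun w : ℝ => w⁻¹) w * ∫ t in δ..w, χ (y t) * t| ≤
      2 * ε * (δ⁻¹ - b⁻¹) := by
    rw [← hinv, ← intervalIntegral.integral_const_mul, ← Real.norm_eq_abs]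
    refine intervalIntegral.norm_integral_le_of_norm_le hbδ.le (.of_forall fun w hw => ?_) ?_
    · rw [hderiv, norm_mul, norm_neg, Real.norm_eq_abs, Real.norm_eq_abs,
        abs_of_nonneg (by positivity : (0 : ℝ) ≤ (w ^ 2)⁻¹), mul_comm]
      exact mul_le_mul_of_nonneg_right (hsub w hw.1.le hw.2) (by positivity)
    · refine (ContinuousOn.intervalIntegrable fun w hw => ?_).const_mul _
      exact (ContinuousAt.inv₀ (continuous_pow 2).continuousAt (pow_ne_zero 2 (hne w hw))).continuousWithinAt
  have hmain : |∫ w in δ..b, χ (y w)| ≤ 2 * δ := by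
    rw [hparts, intervalIntegral.integral_same, mul_zero, sub_zero]
    refine (abs_sub _ _).trans ?_
    have h1 : |b⁻¹ * ∫ t in δ..b, χ (y t) * t| ≤ b⁻¹ * (2 * ε) := by
      have hb' : 0 ≤ b⁻¹ := inv_nonneg.2 hb0
      rw [abs_mul, abs_of_nonneg hb']
      exact mul_le_mul_of_nonneg_left (hsub b hbδ.le le_rfl) hb'
    have h2 : 2 * ε * δ⁻¹ = 2 * δ := by rw [hδ2]; field_simp
    linarith
  rw [← intervalIntegral.integral_add_adjacent_intervals (hint 0 δ le_rfl hδ0.le (hbδ.le.trans hb1))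
    (hint δ b hδ0.le hbδ.le hb1)]
  have := hsmall δ hδ0.le (hbδ.le.trans hb1)
  exact (abs_add_le _ _).trans (by linarith)

/-- Breaking off a stick smooths an oscillating function. -/
theorem abs_integral_comp_stickMap_le {χ : ℝ → ℝ} (hm : Measurable χ)
    (hM : ∀ x ∈ Set.Icc (0 : ℝ) 1, |χ x| ≤ 2) {ε : ℝ} (hε : 0 < ε)
    (hχ : ∀ a b, 0 ≤ a → a ≤ b → b ≤ 1 → |∫ x in a..b, χ x| ≤ 2 * ε) {q : ℝ}
    (hq : q ∈ Set.Icc (0 : ℝ) 1) :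
    |∫ u in (0 : ℝ)..1, χ (stickMap q u)| ≤ 8 * √ε := by
  have hqp : 0 < 1 + q := by linarith [hq.1]
  -- Completing the square: `stickMap q u` = (q + w²)/(1 + q) with w = (1 + q)u - q, which runs from
  -- -q to 1.
  set g : ℝ → ℝ := fun w => χ ((q + w ^ 2) / (1 + q)) with hg
  have hgm : Measurable g := hm.comp (by fun_prop)
  have h1 : ∫ u in (0 : ℝ)..1, χ (stickMap q u) = (1 + q)⁻¹ * ∫ w in (-q)..1, g w := by
    have h := intervalIntegral.integral_comp_mul_sub (a := 0) (b := 1) g hqp.ne' q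
    simp only [mul_zero, zero_sub, mul_one, add_sub_cancel_right, smul_eq_mul] at h
    rw [← h]
    refine intervalIntegral.integral_congr fun u _ => ?_
    simp only [hg, stickMap]
    congr 1
    field_simp
    ring
  have hint : ∀ c d, -1 ≤ c → c ≤ d → d ≤ 1 → IntervalIntegrable g volume c d := by
    intro c d h0 h1 h2
    rw [intervalIntegrable_iff_integrableOn_Ioc_of_le h1]
    refine Measure.integrableOn_of_bounded (M := 2) (by simp) hgm.aestronglyMeasurable ?_
    filter_upwards [ae_restrict_mem measurableSet_Ioc] with w hw
    have hw1 : -1 ≤ w := h0.trans hw.1.le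
    have hw2 : w ≤ 1 := hw.2.trans h2
    refine hM _ ⟨div_nonneg (by nlinarith [hq.1]) hqp.le, ?_⟩
    rw [div_le_one hqp]
    nlinarith
  -- `g` is even, so the part on [-q, 0] reflects to [0, q].
  have h2 : ∫ w in (-q)..1, g w = (∫ w in (0 : ℝ)..q, g w) + ∫ w in (0 : ℝ)..1, g w := by
    rw [← intervalIntegral.integral_add_adjacent_intervals
      (hint (-q) 0 (by linarith [hq.2]) (by linarith [hq.1]) zero_le_one)
      (hint 0 1 (by norm_num) zero_le_one le_rfl)]
    congr 1
    have := intervalIntegral.integral_comp_neg (a := 0) (b := q) g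
    rw [neg_zero] at this
    rw [← this]
    simp [hg]
  have h3 := abs_integral_comp_parabola_le hm hM hε hχ hq hq
  have h4 := abs_integral_comp_parabola_le hm hM hε hχ hq (b := 1) (by simp)
  rw [h1, h2, abs_mul, abs_of_nonneg (by positivity)]
  have h5 : (1 + q)⁻¹ ≤ 1 := inv_le_one_of_one_le₀ (by linarith [hq.1])
  have h6 : |(∫ w in (0 : ℝ)..q, g w) + ∫ w in (0 : ℝ)..1, g w| ≤ 8 * √ε :=
    (abs_add_le _ _).trans (by linarith)
  calc _ ≤ 1 * |(∫ w in (0 : ℝ)..q, g w) + ∫ w in (0 : ℝ)..1, g w| :=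
        mul_le_mul_of_nonneg_right h5 (abs_nonneg _)
    _ ≤ _ := by rw [one_mul]; exact h6

/-- Only the integrals of χ over intervals have to be small, so χ may oscillate. Indicators of null
sets and differences between a sign function and its polynomial approximation are the two uses. -/
theorem abs_integral_loopLaw_le {χ : ℝ → ℝ} (hm : Measurable χ)
    (hM : ∀ x ∈ Set.Icc (0 : ℝ) 1, |χ x| ≤ 2) {ε : ℝ} (hε : 0 < ε)
    (hχ : ∀ a b, 0 ≤ a → a ≤ b → b ≤ 1 → |∫ x in a..b, χ x| ≤ 2 * ε) :
    |∫ x, χ x ∂loopLaw| ≤ 8 * √ε := by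
  rw [integral_loopLaw hm hM]
  have := norm_integral_le_of_norm_le_const (μ := loopLaw) (C := 8 * √ε)
    (f := fun q => ∫ u in (0 : ℝ)..1, χ (stickMap q u)) (by
      filter_upwards [ae_loopLaw_mem_Icc] with q hq
      exact abs_integral_comp_stickMap_le hm hM hε hχ hq)
  simpa using this

/-- The indicator of a null set integrates to 0 over every interval, so the smoothing bound holds
for all ε > 0. -/
theorem loopLaw_absolutelyContinuous : loopLaw ≪ volume := by
  refine Measure.AbsolutelyContinuous.mk fun A hA h0 => ?_
  have hm : Measurable (A.indicator fun _ => (1 : ℝ)) := measurable_const.indicator hA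
  have hz : ∀ ε : ℝ, 0 < ε → |∫ x, A.indicator (fun _ => (1 : ℝ)) x ∂loopLaw| ≤ 8 * √ε := by
    intro ε hε
    refine abs_integral_loopLaw_le hm (fun x _ => ?_) hε fun a b _ _ _ => ?_
    · by_cases hx : x ∈ A <;> simp [hx]
    · have : ∫ x in a..b, A.indicator (fun _ => (1 : ℝ)) x = 0 := by
        refine intervalIntegral.integral_zero_ae ?_
        have : ∀ᵐ x, x ∉ A := by rw [ae_iff]; simpa using h0
        filter_upwards [this] with x hx _
        simp [hx]
      rw [this, abs_zero]
      positivity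
  simp_rw [show (fun _ : ℝ => (1 : ℝ)) = 1 from rfl, integral_indicator_one hA] at hz
  have h1 : loopLaw.real A ≤ 0 := by
    refine le_of_forall_pos_le_add fun η hη => ?_
    have := hz ((η / 8) ^ 2) (by positivity)
    rw [Real.sqrt_sq (by positivity)] at this
    linarith [le_abs_self (loopLaw.real A)]
  have h2 : loopLaw.real A = 0 := le_antisymm h1 measureReal_nonneg
  rwa [measureReal_eq_zero_iff] at h2

end Smoothing

/-! ### Approximation of the density by step functions in L¹. -/

section StepApproximation

/-- The Bernstein basis function. -/
def bernsteinFun (n k : ℕ) (x : ℝ) : ℝ := (n.choose k : ℝ) * x ^ k * (1 - x) ^ (n - k)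

theorem bernsteinFun_eq_eval (n k : ℕ) (x : ℝ) :
    bernsteinFun n k x = (bernsteinPolynomial ℝ n k).eval x := by
  simp [bernsteinFun, bernsteinPolynomial]

theorem continuous_bernsteinFun (n k : ℕ) : Continuous (bernsteinFun n k) := by
  unfold bernsteinFun; fun_prop

theorem bernsteinFun_nonneg (n k : ℕ) {x : ℝ} (hx : x ∈ Set.Icc (0 : ℝ) 1) :
    0 ≤ bernsteinFun n k x := by
  have := hx.1
  have := sub_nonneg.2 hx.2
  unfold bernsteinFun
  positivity

theorem sum_bernsteinFun (n : ℕ) (x : ℝ) :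
    ∑ k ∈ Finset.range (n + 1), bernsteinFun n k x = 1 := by
  have := congrArg (Polynomial.eval x) (bernsteinPolynomial.sum ℝ n)
  simpa [Polynomial.eval_finsetSum, bernsteinFun_eq_eval] using this

theorem variance_bernsteinFun {n : ℕ} (hn : n ≠ 0) {x : ℝ} (hx : x ∈ Set.Icc (0 : ℝ) 1) :
    ∑ k ∈ Finset.range (n + 1), (x - k / n) ^ 2 * bernsteinFun n k x = x * (1 - x) / n := by
  have := bernstein.variance hn ⟨x, hx⟩
  rw [Finset.sum_range]
  simpa [bernstein_apply, bernstein.z, bernsteinFun] using this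

/-- The Bernstein approximation of a Lipschitz function. -/
theorem abs_sub_sum_bernsteinFun_le {Ψ : ℝ → ℝ}
    (hΨ : ∀ x ∈ Set.Icc (0 : ℝ) 1, ∀ y ∈ Set.Icc (0 : ℝ) 1, |Ψ x - Ψ y| ≤ |x - y|) {n : ℕ}
    (hn : n ≠ 0) {x : ℝ} (hx : x ∈ Set.Icc (0 : ℝ) 1) :
    |Ψ x - ∑ k ∈ Finset.range (n + 1), Ψ (k / n) * bernsteinFun n k x| ≤ 1 / √n := by
  have hn0 : (0 : ℝ) < n := by positivity
  set r := √(n : ℝ) with hr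
  have hr0 : 0 < r := Real.sqrt_pos.2 hn0
  have hr2 : r * r = n := Real.mul_self_sqrt hn0.le
  have h1 : Ψ x - ∑ k ∈ Finset.range (n + 1), Ψ (k / n) * bernsteinFun n k x =
      ∑ k ∈ Finset.range (n + 1), (Ψ x - Ψ (k / n)) * bernsteinFun n k x := by
    simp_rw [sub_mul, Finset.sum_sub_distrib, ← Finset.mul_sum, sum_bernsteinFun, mul_one]
  rw [h1]
  refine (Finset.abs_sum_le_sum_abs _ _).trans ?_
  have h2 : ∀ k ∈ Finset.range (n + 1), |(Ψ x - Ψ (k / n)) * bernsteinFun n k x| ≤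
      r / 2 * ((x - k / n) ^ 2 * bernsteinFun n k x) + 1 / (2 * r) * bernsteinFun n k x := by
    intro k hk
    have hk' : (k : ℝ) ≤ n := by exact_mod_cast Nat.lt_succ_iff.1 (Finset.mem_range.1 hk)
    have hb := bernsteinFun_nonneg n k hx
    rw [abs_mul, abs_of_nonneg hb]
    have h3 := hΨ x hx (k / n) ⟨by positivity, (div_le_one hn0).2 hk'⟩
    -- The arithmetic-geometric mean inequality brings in the variance, at most 1/n; with r = √n
    -- each of the two terms sums to at most 1/(2√n).
    have h4 : |x - k / n| ≤ r / 2 * (x - k / n) ^ 2 + 1 / (2 * r) := by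
      rw [← sq_abs (x - k / n)]
      have h5 : r / 2 * |x - k / n| ^ 2 + 1 / (2 * r) - |x - k / n| =
          (r * |x - k / n| - 1) ^ 2 / (2 * r) := by field_simp; ring
      have h6 : 0 ≤ (r * |x - k / n| - 1) ^ 2 / (2 * r) := by positivity
      linarith
    have := mul_le_mul_of_nonneg_right (h3.trans h4) hb
    linarith
  refine (Finset.sum_le_sum h2).trans ?_
  rw [Finset.sum_add_distrib, ← Finset.mul_sum, ← Finset.mul_sum, variance_bernsteinFun hn hx,
    sum_bernsteinFun, ← hr2]
  have h7 : x * (1 - x) ≤ 1 := by nlinarith [hx.1, hx.2]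
  have h8 : r / 2 * (x * (1 - x) / (r * r)) = x * (1 - x) / (2 * r) := by field_simp
  rw [h8]
  have h9 : x * (1 - x) / (2 * r) ≤ 1 / (2 * r) := by gcongr
  have h10 : 1 / (2 * r) + 1 / (2 * r) = 1 / r := by field_simp; ring
  linarith

/-- The derivative of a Bernstein approximation. -/
theorem hasDerivAt_sum_bernsteinFun (n : ℕ) (c : ℕ → ℝ) (x : ℝ) :
    HasDerivAt (fun x => ∑ k ∈ Finset.range (n + 2), c k * bernsteinFun (n + 1) k x)
      (∑ k ∈ Finset.range (n + 1), ((n : ℝ) + 1) * (c (k + 1) - c k) * bernsteinFun n k x) x := by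
  set p : Polynomial ℝ := ∑ k ∈ Finset.range (n + 2),
    Polynomial.C (c k) * bernsteinPolynomial ℝ (n + 1) k with hp
  have h1 : (fun x => ∑ k ∈ Finset.range (n + 2), c k * bernsteinFun (n + 1) k x) =
      fun x => p.eval x := by
    ext x
    simp [hp, Polynomial.eval_finsetSum, bernsteinFun_eq_eval]
  rw [h1]
  refine (p.hasDerivAt x).congr_deriv ?_
  rw [hp, Finset.sum_range_succ']
  simp only [Polynomial.derivative_add, Polynomial.derivative_sum, Polynomial.derivative_C_mul,
    bernsteinPolynomial.derivative_succ, bernsteinPolynomial.derivative_zero,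
    Polynomial.eval_add, Polynomial.eval_finsetSum, Polynomial.eval_mul, Polynomial.eval_C,
    Polynomial.eval_sub, Polynomial.eval_natCast, Polynomial.eval_neg, Nat.add_sub_cancel,
    ← bernsteinFun_eq_eval, Nat.cast_add, Nat.cast_one, Polynomial.eval_one]
  -- Shift of index; the top term vanishes because `n.choose (n + 1) = 0`.
  have h2 : ∑ k ∈ Finset.range (n + 1), c (k + 1) * bernsteinFun n (k + 1) x + c 0 *
      bernsteinFun n 0 x = ∑ k ∈ Finset.range (n + 1), c k * bernsteinFun n k x := by
    rw [← Finset.sum_range_succ' (fun k => c k * bernsteinFun n k x), Finset.sum_range_succ _ (n + 1)]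
    simp [bernsteinFun]
  have h3 : ∑ k ∈ Finset.range (n + 1), ((n : ℝ) + 1) * (c (k + 1) - c k) * bernsteinFun n k x =
      ((n : ℝ) + 1) * (∑ k ∈ Finset.range (n + 1), c (k + 1) * bernsteinFun n k x -
        ∑ k ∈ Finset.range (n + 1), c k * bernsteinFun n k x) := by
    rw [← Finset.sum_sub_distrib, Finset.mul_sum]
    exact Finset.sum_congr rfl fun k _ => by ring
  have h4 : ∑ k ∈ Finset.range (n + 1), c (k + 1) * (((n : ℝ) + 1) *
      (bernsteinFun n k x - bernsteinFun n (k + 1) x)) =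
      ((n : ℝ) + 1) * (∑ k ∈ Finset.range (n + 1), c (k + 1) * bernsteinFun n k x -
        ∑ k ∈ Finset.range (n + 1), c (k + 1) * bernsteinFun n (k + 1) x) := by
    rw [← Finset.sum_sub_distrib, Finset.mul_sum]
    exact Finset.sum_congr rfl fun k _ => by ring
  rw [h3, h4, ← h2]
  ring

/-- Integration against a step function on equal subintervals of `[0, 1]`. -/
theorem integral_mul_step {ψ : ℝ → ℝ} (hψ : ∀ a b, IntervalIntegrable ψ volume a b) (N : ℕ)
    (hN : N ≠ 0) (g : ℕ → ℝ) :
    IntervalIntegrable (fun x => ψ x * g ⌊(N : ℝ) * x⌋₊) volume 0 1 ∧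
    ∫ x in (0 : ℝ)..1, ψ x * g ⌊(N : ℝ) * x⌋₊ =
      ∑ j ∈ Finset.range N, g j * ∫ x in ((j : ℝ) / N)..(((j + 1 : ℕ) : ℝ) / N), ψ x := by
  have hN0 : (0 : ℝ) < N := by positivity
  have hae : ∀ j : ℕ, ∀ᵐ x : ℝ, x ∈ Set.uIoc ((j : ℝ) / N) (((j + 1 : ℕ) : ℝ) / N) →
      ψ x * g ⌊(N : ℝ) * x⌋₊ = g j * ψ x := by
    intro j
    have hj : (j : ℝ) / N ≤ ((j + 1 : ℕ) : ℝ) / N := by gcongr; simp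
    -- At the right end point the floor already jumps to `j + 1`; this is a null set.
    have hne : ∀ᵐ x : ℝ, x ≠ ((j + 1 : ℕ) : ℝ) / N := by simp [ae_iff, measure_singleton]
    filter_upwards [hne] with x hx hxm
    rw [Set.uIoc_of_le hj] at hxm
    have h1 : (j : ℝ) < N * x := by
      have := (div_lt_iff₀ hN0).1 hxm.1
      linarith
    have h2 : N * x < (j : ℝ) + 1 := by
      have := (lt_div_iff₀ hN0).1 (lt_of_le_of_ne hxm.2 hx)
      push_cast at this
      linarith
    have : ⌊(N : ℝ) * x⌋₊ = j := by
      rw [Nat.floor_eq_iff (by linarith [(Nat.cast_nonneg j : (0 : ℝ) ≤ j)])]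
      exact ⟨h1.le, h2⟩
    rw [this, mul_comm]
  have hii : ∀ j : ℕ, IntervalIntegrable (fun x => ψ x * g ⌊(N : ℝ) * x⌋₊) volume
      ((j : ℝ) / N) (((j + 1 : ℕ) : ℝ) / N) := fun j => by
    refine ((hψ _ _).const_mul (g j)).congr_ae ?_
    rw [EventuallyEq, ae_restrict_iff' measurableSet_uIoc]
    filter_upwards [hae j] with x hx hm
    exact (hx hm).symm
  have h01 : ∀ h : ℝ → ℝ, ∫ x in (0 : ℝ)..1, h x =
      ∫ x in (((0 : ℕ) : ℝ) / N)..((N : ℝ) / N), h x := fun h => by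
    rw [div_self hN0.ne']; simp
  constructor
  · have := IntervalIntegrable.trans_iterate (a := fun j : ℕ => (j : ℝ) / N) (n := N)
      (fun j _ => hii j)
    simpa [div_self hN0.ne'] using this
  · rw [h01, ← intervalIntegral.sum_integral_adjacent_intervals
      (a := fun j : ℕ => (j : ℝ) / N) (n := N) fun j _ => hii j]
    refine Finset.sum_congr rfl fun j _ => ?_
    rw [← intervalIntegral.integral_const_mul]
    exact intervalIntegral.integral_congr_ae (hae j)

/-- The weights of the step functions that approximate the density. -/
noncomputable def loopWeight (n j : ℕ) : ℝ := ∫ x, bernsteinFun n j x ∂loopLaw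

/-- The step functions given by the weights are `L¹`-close to the density. -/
theorem integral_abs_density_sub_step_le {f : ℝ → ℝ} (hf : Measurable f) (hf0 : ∀ x, 0 ≤ f x)
    (hfi : IntegrableOn f (Set.Icc 0 1))
    (hL : loopLaw = (volume.restrict (Set.Icc (0 : ℝ) 1)).withDensity
      (fun x => ENNReal.ofReal (f x))) (n : ℕ) :
    ∫ x in Set.Icc (0 : ℝ) 1, |f x - ((n : ℝ) + 1) * loopWeight n ⌊((n : ℝ) + 1) * x⌋₊| ≤
      8 * √(1 / √((n : ℝ) + 1)) := by
  set s : ℝ → ℝ := fun x => ((n : ℝ) + 1) * loopWeight n ⌊((n : ℝ) + 1) * x⌋₊ with hs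
  have hsm : Measurable s := by
    have h1 : Measurable fun x : ℝ => ⌊((n : ℝ) + 1) * x⌋₊ :=
      Nat.measurable_floor.comp (by fun_prop)
    exact measurable_const.mul ((measurable_from_nat (f := loopWeight n)).comp h1)
  -- `ψ` is the sign of f - s, so the L¹ distance is ∫ ψ f - ∫ ψ s, and ∫ ψ f is the integral of `ψ`
  -- against the law.
  set ψ : ℝ → ℝ := fun x => if s x ≤ f x then 1 else -1 with hψ
  have hψm : Measurable ψ :=
    Measurable.ite (measurableSet_le hsm hf) measurable_const measurable_const
  have hψ1 : ∀ x, |ψ x| = 1 := fun x => by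
    simp only [hψ]; split_ifs <;> simp
  have hψi : ∀ a b, IntervalIntegrable ψ volume a b := fun a b => by
    rw [intervalIntegrable_iff]
    refine Measure.integrableOn_of_bounded (M := 1) (by simp) hψm.aestronglyMeasurable ?_
    exact .of_forall fun x => (hψ1 x).le
  set Ψ : ℝ → ℝ := fun x => ∫ t in (0 : ℝ)..x, ψ t with hΨ
  have hΨsub : ∀ a b, Ψ b - Ψ a = ∫ t in a..b, ψ t := fun a b =>
    intervalIntegral.integral_interval_sub_left (hψi _ _) (hψi _ _)
  have hΨlip : ∀ a b, |Ψ b - Ψ a| ≤ |b - a| := fun a b => by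
    rw [hΨsub]
    have := intervalIntegral.norm_integral_le_of_norm_le_const (a := a) (b := b) (C := 1)
      (f := ψ) fun x _ => (hψ1 x).le
    rwa [one_mul] at this
  set c : ℕ → ℝ := fun k => Ψ ((k : ℝ) / ((n : ℝ) + 1)) with hc
  set B : ℝ → ℝ := fun x => ∑ k ∈ Finset.range (n + 2), c k * bernsteinFun (n + 1) k x with hB
  -- `K` is the derivative of the Bernstein approximation `B` of the primitive `Ψ`. Its coefficients
  -- are the means of `ψ` over the subintervals, so integrating `K` against the law gives ∫ ψ s. The
  -- L¹ distance is thus the integral of ψ - K against the law, and the primitive Ψ - B of ψ - K is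
  -- uniformly small.
  set K : ℝ → ℝ := fun x => ∑ k ∈ Finset.range (n + 1),
    ((n : ℝ) + 1) * (c (k + 1) - c k) * bernsteinFun n k x with hK
  have hKc : Continuous K := by
    have := continuous_bernsteinFun n
    fun_prop
  have hBK : ∀ a b, ∫ x in a..b, K x = B b - B a := fun a b =>
    intervalIntegral.integral_eq_sub_of_hasDerivAt
      (fun x _ => hasDerivAt_sum_bernsteinFun n c x) (hKc.intervalIntegrable _ _)
  have hn1 : (0 : ℝ) < (n : ℝ) + 1 := by positivity
  have hK1 : ∀ x ∈ Set.Icc (0 : ℝ) 1, |K x| ≤ 1 := by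
    intro x hx
    refine (Finset.abs_sum_le_sum_abs _ _).trans ?_
    refine le_trans (Finset.sum_le_sum fun k _ => ?_) (sum_bernsteinFun n x).le
    rw [abs_mul, abs_of_nonneg (bernsteinFun_nonneg n k hx)]
    refine mul_le_of_le_one_left (bernsteinFun_nonneg n k hx) ?_
    rw [abs_mul, abs_of_pos hn1]
    have h1 := hΨlip ((k : ℝ) / ((n : ℝ) + 1)) (((k + 1 : ℕ) : ℝ) / ((n : ℝ) + 1))
    rw [← sub_div, Nat.cast_succ, add_sub_cancel_left,
      abs_of_pos (one_div_pos.2 hn1), le_div_iff₀ hn1] at h1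
    simp only [hc, Nat.cast_succ]
    linarith
  have hD : ∀ x ∈ Set.Icc (0 : ℝ) 1, |Ψ x - B x| ≤ 1 / √((n : ℝ) + 1) := by
    intro x hx
    have := abs_sub_sum_bernsteinFun_le (Ψ := Ψ) (fun x _ y _ => hΨlip y x)
      (Nat.succ_ne_zero n) hx
    simpa [hB, hc] using this
  have hχ := abs_integral_loopLaw_le (χ := fun x => ψ x - K x) (hψm.sub hKc.measurable)
    (fun x hx => (abs_sub _ _).trans (by rw [hψ1]; linarith [hK1 x hx]))
    (ε := 1 / √((n : ℝ) + 1)) (by positivity) (fun a b h0 h1 h2 => by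
      rw [intervalIntegral.integral_sub (hψi _ _) (hKc.intervalIntegrable _ _), hBK, ← hΨsub]
      have e1 := hD a ⟨h0, h1.trans h2⟩
      have e2 := hD b ⟨h0.trans h1, h2⟩
      have e3 : Ψ b - Ψ a - (B b - B a) = (Ψ b - B b) - (Ψ a - B a) := by ring
      rw [e3]
      exact (abs_sub _ _).trans (by linarith))
  refine le_trans (le_of_eq ?_) ((le_abs_self _).trans hχ)
  have hint : ∀ g : ℝ → ℝ, Continuous g → Integrable g loopLaw := fun g hg =>
    integrable_of_continuous_of_compl_Icc loopLaw_compl_Icc hg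
  have hψL : Integrable ψ loopLaw :=
    Integrable.of_bound hψm.aestronglyMeasurable 1 (.of_forall fun x => (hψ1 x).le)
  rw [integral_sub hψL (hint K hKc)]
  have hstep := integral_mul_step hψi (n + 1) (Nat.succ_ne_zero n)
    fun j => ((n : ℝ) + 1) * loopWeight n j
  rw [Nat.cast_succ] at hstep
  have hKL : ∫ x, K x ∂loopLaw = ∫ x in (0 : ℝ)..1, ψ x * s x := by
    have hsum : ∫ x, K x ∂loopLaw = ∑ k ∈ Finset.range (n + 1),
        ∫ x, ((n : ℝ) + 1) * (c (k + 1) - c k) * bernsteinFun n k x ∂loopLaw :=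
      integral_finsetSum _ fun k _ => hint _ (continuous_const.mul (continuous_bernsteinFun n k))
    rw [hstep.2, hsum]
    refine Finset.sum_congr rfl fun k _ => ?_
    rw [integral_const_mul, ← hΨsub]
    simp only [hc, loopWeight]
    ring
  have hψf : ∫ x, ψ x ∂loopLaw = ∫ x in Set.Icc (0 : ℝ) 1, ψ x * f x := by
    rw [hL, integral_withDensity_eq_integral_toReal_smul (by fun_prop) (by simp)]
    refine integral_congr_ae (.of_forall fun x => ?_)
    simp [ENNReal.toReal_ofReal (hf0 x), mul_comm]
  have hψfi : Integrable (fun x => ψ x * f x) (volume.restrict (Set.Icc (0 : ℝ) 1)) :=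
    hfi.bdd_mul (c := 1) hψm.aestronglyMeasurable (.of_forall fun x => (hψ1 x).le)
  have hψsi : Integrable (fun x => ψ x * s x) (volume.restrict (Set.Icc (0 : ℝ) 1)) := by
    have := hstep.1
    rw [intervalIntegrable_iff_integrableOn_Icc_of_le zero_le_one] at this
    exact this
  rw [hKL, hψf, intervalIntegral.integral_of_le zero_le_one, ← integral_Icc_eq_integral_Ioc,
    ← integral_sub hψfi hψsi]
  refine integral_congr_ae (.of_forall fun x => ?_)
  simp only [hψ]
  split_ifs with h
  · rw [abs_of_nonneg (sub_nonneg.2 h)]; ring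
  · rw [abs_of_neg (sub_neg.2 (not_le.1 h))]; ring

/-- The law has a density on `[0, 1]`. -/
theorem exists_density_loopLaw : ∃ f : ℝ → ℝ, Measurable f ∧ (∀ x, 0 ≤ f x) ∧
    IntegrableOn f (Set.Icc 0 1) ∧ loopLaw =
      (volume.restrict (Set.Icc (0 : ℝ) 1)).withDensity (fun x => ENNReal.ofReal (f x)) := by
  have hac : loopLaw ≪ volume.restrict (Set.Icc (0 : ℝ) 1) := by
    refine Measure.AbsolutelyContinuous.mk fun A hA h0 => ?_
    rw [Measure.restrict_apply hA] at h0
    refine measure_mono_null (t := (A ∩ Set.Icc 0 1) ∪ (Set.Icc 0 1)ᶜ) (fun x hx => ?_)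
      (measure_union_null (loopLaw_absolutelyContinuous h0) loopLaw_compl_Icc)
    by_cases h : x ∈ Set.Icc (0 : ℝ) 1
    · exact .inl ⟨hx, h⟩
    · exact .inr h
  set ν := volume.restrict (Set.Icc (0 : ℝ) 1) with hν
  refine ⟨fun x => (loopLaw.rnDeriv ν x).toReal, by fun_prop, fun x => ENNReal.toReal_nonneg,
    Measure.integrable_toReal_rnDeriv, ?_⟩
  conv_lhs => rw [← Measure.withDensity_rnDeriv_eq _ _ hac]
  refine withDensity_congr_ae ?_
  filter_upwards [Measure.rnDeriv_lt_top loopLaw ν] with x hx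
  rw [ENNReal.ofReal_toReal hx.ne]

end StepApproximation

/-! ### Primitive recursive computation of the weights. -/

section Computability

/-- A function of two natural numbers whose value at each point is computed from three preceding
values by a primitive recursive rule is primitive recursive. -/
theorem primrec₂_of_grid_rec {F : ℕ → ℕ → ℕ} {H : ℕ × ℕ → ℕ × ℕ × ℕ → ℕ} (hH : Primrec₂ H)
    (h : ∀ a b x y z, (∀ a', a = a' + 1 → x = F a' b) → (∀ b', b = b' + 1 → y = F a b') →
      (∀ a' b', a = a' + 1 → b = b' + 1 → z = F a' b') → F a b = H (a, b) (x, y, z)) :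
    Primrec₂ F := by
  -- Strong recursion along `Nat.pair`: the three neighbours have smaller codes. Beyond the border
  -- truncated subtraction reads an irrelevant entry, which `h` leaves arbitrary.
  have hg : Primrec₂ fun (_ : Unit) (l : List ℕ) => some (H (l.length.unpair)
      (l.getD (Nat.pair (l.length.unpair.1 - 1) l.length.unpair.2) 0,
        l.getD (Nat.pair l.length.unpair.1 (l.length.unpair.2 - 1)) 0,
        l.getD (Nat.pair (l.length.unpair.1 - 1) (l.length.unpair.2 - 1)) 0)) := by
    have hl : Primrec fun p : Unit × List ℕ => p.2 := Primrec.snd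
    have hu : Primrec fun p : Unit × List ℕ => p.2.length.unpair :=
      Primrec.unpair.comp (Primrec.list_length.comp hl)
    have h1 := Primrec.fst.comp hu
    have h2 := Primrec.snd.comp hu
    have h1' := Primrec.nat_sub.comp h1 (Primrec.const 1)
    have h2' := Primrec.nat_sub.comp h2 (Primrec.const 1)
    have hd := Primrec.list_getD (0 : ℕ)
    exact Primrec.option_some.comp (hH.comp hu (Primrec.pair
      (hd.comp hl (Primrec₂.natPair.comp h1' h2)) (Primrec.pair
      (hd.comp hl (Primrec₂.natPair.comp h1 h2'))
      (hd.comp hl (Primrec₂.natPair.comp h1' h2')))))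
  have hrec := Primrec.nat_strong_rec (fun (_ : Unit) n => F n.unpair.1 n.unpair.2) hg (by
    intro _ n
    have hget : ∀ a b, Nat.pair a b < n →
        ((List.range n).map fun n => F n.unpair.1 n.unpair.2).getD (Nat.pair a b) 0 = F a b := by
      intro a b hab
      simp [List.getD_eq_getElem?_getD, hab]
    rw [List.length_map, List.length_range]
    congr 1
    symm
    have hn := Nat.pair_unpair n
    set a := n.unpair.1 with ha
    set b := n.unpair.2 with hb
    refine h a b _ _ _ (fun a' h1 => ?_) (fun b' h2 => ?_) (fun a' b' h1 h2 => ?_)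
    · rw [h1, Nat.add_sub_cancel]
      exact hget _ _ (by rw [← hn, h1]; exact Nat.pair_lt_pair_left _ (Nat.lt_succ_self _))
    · rw [h2, Nat.add_sub_cancel]
      exact hget _ _ (by rw [← hn, h2]; exact Nat.pair_lt_pair_right _ (Nat.lt_succ_self _))
    · rw [h1, h2, Nat.add_sub_cancel, Nat.add_sub_cancel]
      refine hget _ _ ?_
      rw [← hn, h1, h2]
      exact (Nat.pair_lt_pair_left _ (Nat.lt_succ_self _)).trans
        (Nat.pair_lt_pair_right _ (Nat.lt_succ_self _)))
  have : Primrec fun p : ℕ × ℕ => F (Nat.pair p.1 p.2).unpair.1 (Nat.pair p.1 p.2).unpair.2 :=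
    hrec.comp (Primrec.const ()) (Primrec₂.natPair.comp Primrec.fst Primrec.snd)
  exact this.of_eq fun p => by simp

theorem primrec_factorial : Primrec Nat.factorial := by
  have h : Primrec₂ fun (n m : ℕ) => (n + 1) * m :=
    Primrec.nat_mul.comp (Primrec.succ.comp Primrec.fst) Primrec.snd
  refine (Primrec.nat_rec₁ 1 h).of_eq fun n => ?_
  induction n with
  | zero => rfl
  | succ n ih => rw [Nat.factorial_succ, ← ih]

theorem primrec_choose : Primrec₂ Nat.choose := by
  have hb : PrimrecPred fun p : (ℕ × ℕ) × ℕ × ℕ × ℕ => p.1.2 = 0 :=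
    Primrec.eq.comp (Primrec.snd.comp Primrec.fst) (Primrec.const 0)
  have ha : PrimrecPred fun p : (ℕ × ℕ) × ℕ × ℕ × ℕ => p.1.1 = 0 :=
    Primrec.eq.comp (Primrec.fst.comp Primrec.fst) (Primrec.const 0)
  have hx : Primrec fun p : (ℕ × ℕ) × ℕ × ℕ × ℕ => p.2.1 := Primrec.fst.comp Primrec.snd
  have hz : Primrec fun p : (ℕ × ℕ) × ℕ × ℕ × ℕ => p.2.2.2 :=
    Primrec.snd.comp (Primrec.snd.comp Primrec.snd)
  refine primrec₂_of_grid_rec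
    (H := fun ab xyz => if ab.2 = 0 then 1 else if ab.1 = 0 then 0 else xyz.2.2 + xyz.1)
    (Primrec.ite hb (Primrec.const 1) (Primrec.ite ha (Primrec.const 0)
      (Primrec.nat_add.comp hz hx))) ?_
  intro a b x y z h1 h2 h3
  rcases b with _ | b
  · simp
  rcases a with _ | a
  · simp
  simp [h1 a rfl, h3 a b rfl rfl, Nat.choose_succ_succ]

/-- The numbers `(s + 1)! * loopMoment (s - 2 * l) l`. -/
def loopTable : ℕ → ℕ → ℕ
  | 0, _ => 1
  | s + 1, 0 => (s + 1) * loopTable s 0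
  | s + 1, l + 1 => if s + 1 = 2 * (l + 1) then (s + 2) * loopTable s l else
      (s + 1 - 2 * (l + 1)) * loopTable s (l + 1) + 2 * (l + 1) * loopTable s l

/-- With s = k + 2l the recurrence divides by s + 1 and refers to s - 1, so the factor (s + 1)!
clears all denominators. -/
theorem loopTable_eq (s : ℕ) : ∀ l, 2 * l ≤ s →
    (loopTable s l : ℚ) = (s + 1).factorial * loopMoment (s - 2 * l) l := by
  induction s with
  | zero =>
    intro l hl
    obtain rfl : l = 0 := by omega
    simp [loopTable, loopMoment_zero_zero]
  | succ s ih =>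
    intro l hl
    have hrec := loopMoment_rec (s + 1 - 2 * l) l
    rw [Nat.factorial_succ (s + 1)]
    rcases l with _ | l
    · have := ih 0 (by omega)
      simp only [mul_zero, Nat.sub_zero, Nat.add_sub_cancel, Nat.cast_zero, zero_mul, add_zero,
        Nat.succ_ne_zero, if_false] at hrec this ⊢
      rw [loopTable]
      push_cast at hrec ⊢
      rw [this]
      linear_combination -((s + 1).factorial : ℚ) * hrec
    · rw [loopTable]
      split_ifs with h
      · have h0 : s + 1 - 2 * (l + 1) = 0 := by omega
        have := ih l (by omega)
        rw [h0, loopMoment_zero_succ]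
        rw [show s - 2 * l = 1 by omega] at this
        push_cast
        rw [this]
        ring
      · have h1 := ih (l + 1) (by omega)
        have h2 := ih l (by omega)
        have hk : s + 1 - 2 * (l + 1) = (s - 2 * (l + 1)) + 1 := by omega
        rw [hk] at hrec ⊢
        rw [show s - 2 * l = s - 2 * (l + 1) + 1 + 1 by omega] at h2
        simp only [Nat.add_sub_cancel, Nat.succ_ne_zero, if_false, add_zero] at hrec
        have hs : ((s - 2 * (l + 1) : ℕ) : ℚ) = s - 2 * (l + 1) := by
          rw [Nat.cast_sub (by omega)]; push_cast; ring
        push_cast at hrec ⊢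
        rw [h1, h2]
        rw [hs] at hrec ⊢
        linear_combination -((s + 1).factorial : ℚ) * hrec

theorem primrec_loopTable : Primrec₂ loopTable := by
  have hs : Primrec fun p : (ℕ × ℕ) × ℕ × ℕ × ℕ => p.1.1 := Primrec.fst.comp Primrec.fst
  have hl : Primrec fun p : (ℕ × ℕ) × ℕ × ℕ × ℕ => 2 * p.1.2 :=
    Primrec.nat_mul.comp (Primrec.const 2) (Primrec.snd.comp Primrec.fst)
  have hx : Primrec fun p : (ℕ × ℕ) × ℕ × ℕ × ℕ => p.2.1 := Primrec.fst.comp Primrec.snd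
  have hz : Primrec fun p : (ℕ × ℕ) × ℕ × ℕ × ℕ => p.2.2.2 :=
    Primrec.snd.comp (Primrec.snd.comp Primrec.snd)
  have h0 : PrimrecPred fun p : (ℕ × ℕ) × ℕ × ℕ × ℕ => p.1.1 = 0 :=
    Primrec.eq.comp hs (Primrec.const 0)
  have hl0 : PrimrecPred fun p : (ℕ × ℕ) × ℕ × ℕ × ℕ => p.1.2 = 0 :=
    Primrec.eq.comp (Primrec.snd.comp Primrec.fst) (Primrec.const 0)
  have he : PrimrecPred fun p : (ℕ × ℕ) × ℕ × ℕ × ℕ => p.1.1 = 2 * p.1.2 := Primrec.eq.comp hs hl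
  refine primrec₂_of_grid_rec
    (H := fun sl xyz => if sl.1 = 0 then 1 else if sl.2 = 0 then sl.1 * xyz.1 else
      if sl.1 = 2 * sl.2 then (sl.1 + 1) * xyz.2.2 else
        (sl.1 - 2 * sl.2) * xyz.1 + 2 * sl.2 * xyz.2.2)
    (Primrec.ite h0 (Primrec.const 1) (Primrec.ite hl0 (Primrec.nat_mul.comp hs hx)
      (Primrec.ite he (Primrec.nat_mul.comp (Primrec.succ.comp hs) hz)
        (Primrec.nat_add.comp (Primrec.nat_mul.comp (Primrec.nat_sub.comp hs hl) hx)
          (Primrec.nat_mul.comp hl hz))))) ?_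
  intro s l x y z h1 h2 h3
  rcases s with _ | s
  · simp [loopTable]
  rcases l with _ | l
  · simp [loopTable, h1 s rfl]
  simp [loopTable, h1 s rfl, h3 s l rfl rfl]

/-- The numbers `(2 * t + 1)!` times the integral of `x ^ (t - i) * (1 - x) ^ i`. -/
def loopDiffTable : ℕ → ℕ → ℕ
  | t, 0 => loopTable (2 * t) t
  | t, i + 1 => (2 * t + 1) * (2 * t) * loopDiffTable (t - 1) i - loopDiffTable t i

/-- The rule is x^a (1 - x)^(i+1) = x^a (1 - x)^i - x^(a+1) (1 - x)^i, and (2t + 1)(2t) adjusts the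
factorial. The natural subtraction does not truncate because the difference is a nonnegative
integral. -/
theorem loopDiffTable_eq (i : ℕ) : ∀ t, i ≤ t → (loopDiffTable t i : ℝ) =
    (2 * t + 1).factorial * ∫ x, x ^ (t - i) * (1 - x) ^ i ∂loopLaw := by
  have hint : ∀ g : ℝ → ℝ, Continuous g → Integrable g loopLaw := fun g hg =>
    integrable_of_continuous_of_compl_Icc loopLaw_compl_Icc hg
  induction i with
  | zero =>
    intro t _
    have h := congrArg (Rat.cast : ℚ → ℝ) (loopTable_eq (2 * t) t le_rfl)
    push_cast at h
    rw [loopDiffTable, h]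
    simp [integral_pow_loopLaw]
  | succ i ih =>
    intro t ht
    obtain ⟨t, rfl⟩ : ∃ r, t = r + 1 := ⟨t - 1, by omega⟩
    have h1 := ih t (by omega)
    have h2 := ih (t + 1) (by omega)
    have hkey : ((2 * (t + 1) + 1) * (2 * (t + 1)) * loopDiffTable t i : ℕ) =
        ((2 * (t + 1) + 1).factorial * ∫ x, x ^ (t - i) * (1 - x) ^ (i + 1) ∂loopLaw) +
          (loopDiffTable (t + 1) i : ℝ) := by
      push_cast
      rw [h1, h2, ← mul_add, ← integral_add (hint _ (by fun_prop)) (hint _ (by fun_prop)),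
        show 2 * (t + 1) + 1 = (2 * t + 1) + 1 + 1 by ring, Nat.factorial_succ (2 * t + 1 + 1),
        Nat.factorial_succ (2 * t + 1), show t + 1 - i = (t - i) + 1 by omega]
      push_cast
      have : ∀ x : ℝ, x ^ (t - i) * (1 - x) ^ (i + 1) + x ^ (t - i + 1) * (1 - x) ^ i =
          x ^ (t - i) * (1 - x) ^ i := fun x => by ring
      simp_rw [this]
      ring
    have hpos : 0 ≤ ∫ x, x ^ (t - i) * (1 - x) ^ (i + 1) ∂loopLaw := by
      refine integral_nonneg_of_ae ?_
      filter_upwards [ae_loopLaw_mem_Icc] with x hx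
      exact mul_nonneg (pow_nonneg hx.1 _) (pow_nonneg (sub_nonneg.2 hx.2) _)
    have hle : loopDiffTable (t + 1) i ≤ (2 * (t + 1) + 1) * (2 * (t + 1)) * loopDiffTable t i := by
      have : (loopDiffTable (t + 1) i : ℝ) ≤
          ((2 * (t + 1) + 1) * (2 * (t + 1)) * loopDiffTable t i : ℕ) := by
        rw [hkey]
        have := mul_nonneg (Nat.cast_nonneg (α := ℝ) (2 * (t + 1) + 1).factorial) hpos
        linarith
      exact_mod_cast this
    rw [loopDiffTable, Nat.add_sub_cancel, Nat.cast_sub hle, hkey, Nat.add_sub_add_right]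
    ring

theorem primrec_loopDiffTable : Primrec₂ loopDiffTable := by
  have ht : Primrec fun p : (ℕ × ℕ) × ℕ × ℕ × ℕ => p.1.1 := Primrec.fst.comp Primrec.fst
  have hi : Primrec fun p : (ℕ × ℕ) × ℕ × ℕ × ℕ => p.1.2 := Primrec.snd.comp Primrec.fst
  have h2t : Primrec fun p : (ℕ × ℕ) × ℕ × ℕ × ℕ => 2 * p.1.1 :=
    Primrec.nat_mul.comp (Primrec.const 2) ht
  have hy : Primrec fun p : (ℕ × ℕ) × ℕ × ℕ × ℕ => p.2.2.1 :=
    Primrec.fst.comp (Primrec.snd.comp Primrec.snd)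
  have hz : Primrec fun p : (ℕ × ℕ) × ℕ × ℕ × ℕ => p.2.2.2 :=
    Primrec.snd.comp (Primrec.snd.comp Primrec.snd)
  have hi0 : PrimrecPred fun p : (ℕ × ℕ) × ℕ × ℕ × ℕ => p.1.2 = 0 :=
    Primrec.eq.comp hi (Primrec.const 0)
  refine primrec₂_of_grid_rec
    (H := fun ti xyz => if ti.2 = 0 then loopTable (2 * ti.1) ti.1 else
      (2 * ti.1 + 1) * (2 * ti.1) * xyz.2.2 - xyz.2.1)
    (Primrec.ite hi0 (primrec_loopTable.comp h2t ht) (Primrec.nat_sub.comp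
      (Primrec.nat_mul.comp (Primrec.nat_mul.comp (Primrec.succ.comp h2t) h2t) hz) hy)) ?_
  intro t i x y z h1 h2 h3
  rcases i with _ | i
  · simp [loopDiffTable]
  rcases t with _ | t
  · simp [loopDiffTable]
  simp [loopDiffTable, h2 i rfl, h3 t i rfl rfl]

/-- The weights of the step functions as quotients of natural numbers. -/
theorem loopWeight_eq (n j : ℕ) :
    loopWeight n j = (n.choose j * loopDiffTable n (n - j) : ℕ) / (2 * n + 1).factorial := by
  have hf : ((2 * n + 1).factorial : ℝ) ≠ 0 := by positivity
  rw [eq_div_iff hf]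
  by_cases hj : j ≤ n
  · push_cast
    rw [loopDiffTable_eq (n - j) n (Nat.sub_le _ _), Nat.sub_sub_self hj, loopWeight]
    unfold bernsteinFun
    simp_rw [mul_assoc]
    rw [integral_const_mul]
    ring
  · simp [loopWeight, bernsteinFun, Nat.choose_eq_zero_of_lt (not_le.1 hj)]

theorem exists_isComputableDensity_loopLaw : ∃ f : ℝ → ℝ, IsComputableDensity f ∧
    loopLaw = (volume.restrict (Set.Icc (0 : ℝ) 1)).withDensity (fun x => ENNReal.ofReal (f x)) := by
  obtain ⟨f, hf, hf0, hfi, hL⟩ := exists_density_loopLaw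
  -- 16^(m+3) subintervals give the error 8 · 2^(-(m+3)) = 2^(-m). Here and in the denominator, 1 is
  -- subtracted because `IsComputableDensity` adds it back.
  have hN : Primrec fun m : ℕ => 16 ^ (m + 3) - 1 := by
    have hp : Primrec fun m : ℕ => 16 ^ m := by
      have h : Primrec₂ fun (_ m : ℕ) => 16 * m :=
        Primrec.nat_mul.comp (Primrec.const 16) Primrec.snd
      refine (Primrec.nat_rec₁ 1 h).of_eq fun n => ?_
      induction n with
      | zero => rfl
      | succ n ih => rw [pow_succ', ← ih]
    exact Primrec.nat_sub.comp
      (hp.comp (Primrec.nat_add.comp Primrec.id (Primrec.const 3))) (Primrec.const 1)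
  set N : ℕ → ℕ := fun m => 16 ^ (m + 3) - 1 with hNdef
  have hd : Primrec fun m => (2 * N m + 1).factorial - 1 :=
    Primrec.nat_sub.comp (primrec_factorial.comp (Primrec.succ.comp
      (Primrec.nat_mul.comp (Primrec.const 2) hN))) (Primrec.const 1)
  have ha : Primrec₂ fun m j =>
      (N m + 1) * ((N m).choose j * loopDiffTable (N m) (N m - j)) := by
    have hNm : Primrec fun p : ℕ × ℕ => N p.1 := hN.comp Primrec.fst
    exact Primrec.nat_mul.comp (Primrec.succ.comp hNm) (Primrec.nat_mul.comp
      (primrec_choose.comp hNm Primrec.snd)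
      (primrec_loopDiffTable.comp hNm (Primrec.nat_sub.comp hNm Primrec.snd)))
  refine ⟨f, ⟨hf, hf0, hfi, N, _, _, hN.to_comp, hd.to_comp, ha.to_comp, fun m => ?_⟩, hL⟩
  have h := integral_abs_density_sub_step_le hf hf0 hfi hL (N m)
  have hN1 : (N m : ℝ) + 1 = 16 ^ (m + 3) := by
    have : N m + 1 = 16 ^ (m + 3) := Nat.sub_add_cancel (Nat.one_le_pow' _ 15)
    exact_mod_cast this
  have hfac : (((2 * N m + 1).factorial - 1 : ℕ) : ℝ) + 1 = (2 * N m + 1).factorial := by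
    have : (2 * N m + 1).factorial - 1 + 1 = (2 * N m + 1).factorial :=
      Nat.sub_add_cancel (Nat.factorial_pos _)
    exact_mod_cast this
  have hbound : 8 * √(1 / √((N m : ℝ) + 1)) = (1 / 2 : ℝ) ^ m := by
    rw [hN1, show (16 : ℝ) ^ (m + 3) = ((4 : ℝ) ^ (m + 3)) ^ 2 by rw [← pow_mul, mul_comm, pow_mul]; norm_num,
      Real.sqrt_sq (by positivity),
      show 1 / (4 : ℝ) ^ (m + 3) = ((1 / 2 : ℝ) ^ (m + 3)) ^ 2 by
        rw [← pow_mul, mul_comm, pow_mul, one_div, ← inv_pow]; norm_num,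
      Real.sqrt_sq (by positivity), pow_add]
    norm_num
    ring
  rw [hbound] at h
  refine le_trans (le_of_eq ?_) h
  refine integral_congr_ae (.of_forall fun x => ?_)
  simp only
  rw [hfac, loopWeight_eq]
  push_cast
  rw [mul_div_assoc]

end Computability

/-! ### Most permutations give a connected map. -/

section Connectivity

open Finset

theorem Nat.choose_two_le_choose (n : ℕ) : ∀ k, 2 ≤ k → k + 2 ≤ n → n.choose 2 ≤ n.choose k := by
  induction n with
  | zero => intro k _ h; omega
  | succ n ih =>
    intro k h2 hn
    rcases h2.eq_or_lt with rfl | h3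
    · exact le_rfl
    rcases hn.eq_or_lt with h | h4
    · rw [← Nat.choose_symm_of_eq_add (show n + 1 = 2 + k by omega)]
    obtain ⟨j, rfl⟩ : ∃ j, k = j + 1 := ⟨k - 1, by omega⟩
    rw [Nat.choose_succ_succ' n j]
    have h5 := ih j (by omega) (by omega)
    have h6 := ih (j + 1) (by omega) (by omega)
    have h7 : n ≤ n.choose 2 := by
      rw [Nat.choose_two_right, Nat.le_div_iff_mul_le two_pos]
      exact Nat.mul_le_mul_left n (by omega)
    have h8 : (n + 1).choose 2 = n + n.choose 2 := by
      rw [Nat.choose_succ_succ' n 1, Nat.choose_one_right]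
    omega

/-- The terms k = 1 and k = n - 1 contribute 1/n each; every other binomial coefficient is at least
`n.choose 2`. -/
theorem sum_inv_choose_le {n : ℕ} (hn : 2 ≤ n) :
    ∑ k ∈ Ico 1 n, ((n.choose k : ℝ))⁻¹ ≤ 2 / n + 2 / (n - 1) := by
  have hn1 : (0 : ℝ) < n - 1 := by
    have : (2 : ℝ) ≤ n := by exact_mod_cast hn
    linarith
  have hn0 : (0 : ℝ) < n := by linarith
  have h : ∀ k ∈ Ico 1 n, ((n.choose k : ℝ))⁻¹ ≤ (if k = 1 then (1 / n : ℝ) else 0) +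
      (if k = n - 1 then (1 / n : ℝ) else 0) + 2 / (n * (n - 1)) := by
    intro k hk
    rw [mem_Ico] at hk
    have p1 : (0 : ℝ) ≤ if k = 1 then (1 / n : ℝ) else 0 := by positivity
    have p2 : (0 : ℝ) ≤ if k = n - 1 then (1 / n : ℝ) else 0 := by positivity
    have p3 : (0 : ℝ) ≤ 2 / (n * (n - 1)) := by positivity
    by_cases h1 : k = 1
    · subst h1
      rw [Nat.choose_one_right, if_pos rfl, ← one_div]
      linarith
    by_cases h2 : k = n - 1
    · have h3 : n.choose k = n := by
        rw [h2, Nat.choose_symm (by omega), Nat.choose_one_right]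
      rw [if_pos h2, h3, ← one_div]
      linarith
    · have h3 := Nat.choose_two_le_choose n k (by omega) (by omega)
      have h4 : (n.choose 2 : ℝ) = n * (n - 1) / 2 := Nat.cast_choose_two ℝ n
      have h5 : (n : ℝ) * (n - 1) / 2 ≤ n.choose k := by rw [← h4]; exact_mod_cast h3
      have h6 : ((n.choose k : ℝ))⁻¹ ≤ ((n : ℝ) * (n - 1) / 2)⁻¹ := inv_anti₀ (by positivity) h5
      rw [inv_div] at h6
      linarith
  refine (sum_le_sum h).trans ?_
  rw [sum_add_distrib, sum_add_distrib, sum_ite_eq', sum_ite_eq', sum_const, Nat.card_Ico,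
    nsmul_eq_mul, if_pos (by simp; omega), if_pos (by simp; omega), Nat.cast_sub (by omega),
    Nat.cast_one]
  have : ((n : ℝ) - 1) * (2 / (n * (n - 1))) = 2 / n := by field_simp
  rw [this]
  have h7 : (2 : ℝ) / n ≤ 2 / (n - 1) := by gcongr; linarith
  have h8 : (1 : ℝ) / n + 1 / n = 2 / n := by ring
  linarith

theorem Nat.choose_sq_le_choose_two_mul (n k : ℕ) :
    n.choose k * n.choose k ≤ (2 * n).choose (2 * k) := by
  rw [two_mul, Nat.add_choose_eq]
  exact single_le_sum (f := fun ij : ℕ × ℕ => n.choose ij.1 * n.choose ij.2)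
    (fun _ _ => Nat.zero_le _) (a := (k, k)) (by simp [two_mul])

variable {α : Type*} [DecidableEq α] [Fintype α]

/-- The number of permutations that preserve a set. -/
theorem card_perms_preserving (A : Finset α) :
    (univ.filter fun σ : Equiv.Perm α => ∀ a, σ a ∈ A ↔ a ∈ A).card =
      A.card.factorial * (Fintype.card α - A.card).factorial := by
  classical
  have h := DomMulAct.stabilizer_card (fun a : α => decide (a ∈ A))
  rw [Fintype.card_subtype] at h
  have h1 : Fintype.card {a // decide (a ∈ A) = true} = A.card := by
    rw [Fintype.card_subtype]; congr 1; ext; simp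
  have h2 : Fintype.card {a // decide (a ∈ A) = false} = Fintype.card α - A.card := by
    rw [Fintype.card_subtype, ← card_compl]; congr 1; ext; simp
  rw [Fintype.prod_bool, h1, h2] at h
  rw [← h]
  congr 1
  ext σ
  simp [funext_iff]

/-- The group generated by two permutations acts transitively. -/
def PairTransitive (σ τ : Equiv.Perm α) : Prop :=
  ∀ h h' : α, ∃ g ∈ Subgroup.closure {σ, τ}, g h = h'

/-- Few permutations fail to generate a transitive group together with a given pairing. -/
theorem card_not_pairTransitive_le {n : ℕ} (hn : 2 ≤ n) (hc : Fintype.card α = 2 * n)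
    {p : Equiv.Perm α} (hp : ∀ a, p (p a) = a) (hne : ∀ a, p a ≠ a) (C : Finset (Equiv.Perm α))
    (hC : ∀ σ ∈ C, ¬ PairTransitive σ p) :
    (C.card : ℝ) ≤ (2 * n).factorial * (2 / n + 2 / (n - 1)) := by
  classical
  have hcard : (pairEdges p).card = n := by
    have := two_mul_card_pairEdges hp hne
    omega
  -- An orbit of a non-transitive group is the set of half-edges of a nonempty proper set `T` of
  -- edges, which `σ` preserves; a union bound over `T` follows.
  set S := (pairEdges p).powerset.filter fun T => T.card ∈ Ico 1 n with hS
  have hsub : C ⊆ S.biUnion fun T =>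
      univ.filter fun σ : Equiv.Perm α => ∀ a, σ a ∈ halfEdges p T ↔ a ∈ halfEdges p T := by
    intro σ hσ
    have hσ := hC σ hσ
    unfold PairTransitive at hσ
    push Not at hσ
    obtain ⟨h, h', hh⟩ := hσ
    let A : Finset α := univ.filter fun a => ∃ g ∈ Subgroup.closure {σ, p}, g h = a
    have hmem : ∀ a, a ∈ A ↔ ∃ g ∈ Subgroup.closure {σ, p}, g h = a := fun a => by simp [A]
    have hinv : ∀ τ ∈ Subgroup.closure {σ, p}, ∀ a, τ a ∈ A ↔ a ∈ A := by
      intro τ hτ a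
      rw [hmem, hmem]
      constructor
      · rintro ⟨g, hg, hga⟩
        exact ⟨τ⁻¹ * g, mul_mem (inv_mem hτ) hg, by simp [hga]⟩
      · rintro ⟨g, hg, hga⟩
        exact ⟨τ * g, mul_mem hτ hg, by simp [hga]⟩
    have hσm : σ ∈ Subgroup.closure {σ, p} := Subgroup.subset_closure (by simp)
    have hpm : p ∈ Subgroup.closure {σ, p} := Subgroup.subset_closure (by simp)
    set T := A.image fun a => s(a, p a) with hT
    have hTsub : T ⊆ pairEdges p := image_subset_image (subset_univ _)
    have hTA : halfEdges p T = A := by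
      ext a
      rw [mem_halfEdges, hT, mem_image]
      constructor
      · rintro ⟨b, hb, hab⟩
        rcases (sym2_partner_eq_iff hp).1 hab with rfl | rfl
        · exact hb
        · exact (hinv p hpm a).1 hb
      · exact fun ha => ⟨a, ha, rfl⟩
    have hTc := card_halfEdges hp hne hTsub
    rw [hTA] at hTc
    have h0 : 0 < A.card := card_pos.2 ⟨h, (hmem h).2 ⟨1, one_mem _, rfl⟩⟩
    have h1 : A.card < Fintype.card α := by
      rw [← card_univ]
      refine card_lt_card ((ssubset_univ_iff).2 fun hA => ?_)
      obtain ⟨g, hg, hgh⟩ := (hmem h').1 (hA ▸ mem_univ h')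
      exact hh g hg hgh
    refine mem_biUnion.2 ⟨T, mem_filter.2 ⟨mem_powerset.2 hTsub, mem_Ico.2 ?_⟩, ?_⟩
    · omega
    · rw [hTA]
      exact mem_filter.2 ⟨mem_univ _, hinv σ hσm⟩
  have hle : C.card ≤ ∑ T ∈ S, ((2 * T.card).factorial * (2 * n - 2 * T.card).factorial) := by
    refine (card_le_card hsub).trans (card_biUnion_le.trans (sum_le_sum fun T hT => le_of_eq ?_))
    rw [card_perms_preserving, card_halfEdges hp hne (mem_powerset.1 (mem_filter.1 hT).1), hc]
  have hsum : ∑ T ∈ S, ((2 * T.card).factorial * (2 * n - 2 * T.card).factorial) =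
      ∑ k ∈ Ico 1 n, n.choose k * ((2 * k).factorial * (2 * n - 2 * k).factorial) := by
    rw [hS, sum_filter, sum_powerset_apply_card (fun k => if k ∈ Ico 1 n then
      (2 * k).factorial * (2 * n - 2 * k).factorial else 0), hcard]
    simp_rw [smul_ite, smul_zero]
    rw [← sum_filter]
    refine sum_congr ?_ fun _ _ => rfl
    ext k
    simp only [mem_filter, mem_range, mem_Ico]
    omega
  rw [hsum] at hle
  have hle' : (C.card : ℝ) ≤
      ∑ k ∈ Ico 1 n, (2 * n).factorial * ((n.choose k : ℝ))⁻¹ := by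
    refine (Nat.cast_le.2 hle).trans ?_
    rw [Nat.cast_sum]
    refine sum_le_sum fun k hk => ?_
    rw [mem_Ico] at hk
    have hpos : (0 : ℝ) < n.choose k := by exact_mod_cast Nat.choose_pos hk.2.le
    rw [← div_eq_mul_inv, le_div_iff₀ hpos]
    have h1 := Nat.choose_mul_factorial_mul_factorial (show 2 * k ≤ 2 * n by omega)
    -- Since C(n,k)² ≤ C(2n,2k), the sets of k edges account for at most (2n)!/C(n,k) permutations.
    have h2 := Nat.mul_le_mul_right ((2 * k).factorial * (2 * n - 2 * k).factorial)
      (Nat.choose_sq_le_choose_two_mul n k)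
    have h3 : n.choose k * ((2 * k).factorial * (2 * n - 2 * k).factorial) * n.choose k ≤
        (2 * n).factorial := by
      rw [← h1, mul_assoc ((2 * n).choose (2 * k))]
      linarith
    exact_mod_cast h3
  rw [← mul_sum] at hle'
  exact hle'.trans (mul_le_mul_of_nonneg_left (sum_inv_choose_le hn) (by positivity))

end Connectivity

/-! ### Labelled maps and relabelling. -/

namespace LabelledRootedMap

variable {n : ℕ}

noncomputable instance : Fintype (LabelledRootedMap n) := Fintype.ofFinite _

theorem loops_ncard (M : LabelledRootedMap n) : M.loops.ncard = (loopEdges M.opp M.next).card := by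
  have : M.loops = (loopEdges M.opp M.next : Set (Sym2 (Fin (2 * n)))) := by
    ext e
    simp [loops, loopEdges, eq_comm, and_comm]
  rw [this, Set.ncard_coe_finset]

/-- The relabelling of a map by a permutation of the half-edges. -/
def relabel (e : Equiv.Perm (Fin (2 * n))) (M : LabelledRootedMap n) : LabelledRootedMap n where
  next := e * M.next * e⁻¹
  opp := e * M.opp * e⁻¹
  opp_opp h := by simp [M.opp_opp]
  opp_ne h := by
    intro hh
    refine M.opp_ne (e⁻¹ h) ?_
    apply e.injective
    simpa using hh
  connected h h' := by
    obtain ⟨g, hg, hgh⟩ := M.connected (e⁻¹ h) (e⁻¹ h')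
    refine ⟨e * g * e⁻¹, ?_, (congrArg e hgh).trans (e.apply_symm_apply h')⟩
    have hmap : Subgroup.closure {e * M.next * e⁻¹, e * M.opp * e⁻¹} =
        (Subgroup.closure {M.next, M.opp}).map (MulAut.conj e).toMonoidHom := by
      rw [MonoidHom.map_closure, Set.image_pair]
      rfl
    rw [hmap]
    exact ⟨g, hg, rfl⟩
  root := M.root.map e
  root_eq_none := by rw [Option.map_eq_none_iff, M.root_eq_none]

theorem iso_relabel (e : Equiv.Perm (Fin (2 * n))) (M : LabelledRootedMap n) :
    Iso M (relabel e M) := ⟨e, by simp [relabel], by simp [relabel], rfl⟩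

/-- A rooted map with an edge has no automorphism. -/
theorem relabel_injective (hn : 0 < n) (M : LabelledRootedMap n) :
    Function.Injective fun e => relabel e M := by
  intro e e' h
  have h : relabel e M = relabel e' M := h
  obtain ⟨r, hr⟩ : ∃ r, M.root = some r := by
    rw [← Option.ne_none_iff_exists', Ne, M.root_eq_none]
    omega
  have hroot : e r = e' r := by
    have := congrArg root h
    simpa [relabel, hr] using this
  -- The two relabellings agree at the root and conjugate the whole group alike; by connectivity the
  -- group carries the root to every half-edge.
  have hcomm : ∀ g ∈ Subgroup.closure {M.next, M.opp}, e * g * e⁻¹ = e' * g * e'⁻¹ := by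
    intro g hg
    have : (Subgroup.closure {M.next, M.opp} : Subgroup _) ≤
        (MulAut.conj e).toMonoidHom.eqLocus (MulAut.conj e').toMonoidHom := by
      rw [Subgroup.closure_le]
      rintro x (rfl | rfl)
      · exact congrArg next h
      · exact congrArg opp h
    exact this hg
  ext x
  obtain ⟨g, hg, rfl⟩ := M.connected r x
  have := congrArg (fun τ : Equiv.Perm _ => τ (e r)) (hcomm g hg)
  simp only [Equiv.Perm.mul_apply] at this
  rw [Equiv.Perm.inv_def, Equiv.symm_apply_apply, hroot, Equiv.Perm.inv_def,
    Equiv.symm_apply_apply] at this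
  rw [this]

theorem exists_relabel_of_iso {M M' : LabelledRootedMap n} (h : Iso M M') :
    ∃ e, relabel e M = M' := by
  obtain ⟨e, h1, h2, h3⟩ := h
  refine ⟨e, LabelledRootedMap.ext ?_ ?_ h3⟩
  · ext x; simp [relabel, h1]
  · ext x; simp [relabel, h2]

theorem card_filter_iso (hn : 0 < n) (M : LabelledRootedMap n) (C : Finset (LabelledRootedMap n))
    (hC : ∀ M', M' ∈ C ↔ Iso M M') : C.card = (2 * n).factorial := by
  classical
  have : C = Finset.univ.image fun e => relabel e M := by
    ext M'
    rw [hC, Finset.mem_image]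
    constructor
    · intro h
      obtain ⟨e, he⟩ := exists_relabel_of_iso h
      exact ⟨e, Finset.mem_univ _, he⟩
    · rintro ⟨e, -, rfl⟩
      exact iso_relabel e M
  rw [this, Finset.card_image_of_injective _ (relabel_injective hn M), Finset.card_univ,
    Fintype.card_perm, Fintype.card_fin]

end LabelledRootedMap

/-! ### Convergence in distribution. -/

section Limit

open Finset

variable {n : ℕ}

noncomputable instance : Fintype (RootedMap n) := Fintype.ofFinite _

/-- Every isomorphism class has exactly (2n)! labellings, so the number of loops has the same law
for uniform labelled and uniform rooted maps. -/
theorem sum_labelledRootedMap (hn : 0 < n) (F : ℕ → ℝ) :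
    ∑ M : LabelledRootedMap n, F M.loops.ncard =
      (2 * n).factorial * ∑ M : RootedMap n, F M.numLoops := by
  classical
  let π : LabelledRootedMap n → RootedMap n := Quotient.mk _
  rw [← sum_fiberwise univ π, mul_sum]
  refine sum_congr rfl fun Q _ => ?_
  obtain ⟨M, rfl⟩ : ∃ M, π M = Q := Quotient.exists_rep Q
  have hF : ∀ M' ∈ univ.filter (fun M' => π M' = π M), F M'.loops.ncard = F (π M).numLoops :=
    fun M' hM' => by rw [← (mem_filter.1 hM').2]; rfl
  rw [sum_congr rfl hF, sum_const, nsmul_eq_mul]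
  congr 2
  refine LabelledRootedMap.card_filter_iso hn M _ fun M' => ?_
  rw [mem_filter]
  refine ⟨fun h => LabelledRootedMap.Iso.symm (Quotient.exact h.2), fun h => ⟨mem_univ _, ?_⟩⟩
  exact Quotient.sound (LabelledRootedMap.Iso.symm h)

theorem integral_uniform (F : RootedMap n → ℝ) :
    ∫ M, F M ∂(RootedMap.uniform n) = (Fintype.card (RootedMap n) : ℝ)⁻¹ * ∑ M, F M := by
  rw [RootedMap.uniform, ProbabilityTheory.uniformOn, ProbabilityTheory.cond,
    integral_smul_measure, Measure.restrict_univ, integral_count, Measure.count_univ]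
  simp

theorem integral_uniform_numLoops (hn : 0 < n) (F : ℕ → ℝ) :
    ∫ M, F M.numLoops ∂(RootedMap.uniform n) =
      (Fintype.card (LabelledRootedMap n) : ℝ)⁻¹ * ∑ M : LabelledRootedMap n, F M.loops.ncard := by
  have h1 := sum_labelledRootedMap hn (fun _ => 1)
  simp only [sum_const, nsmul_eq_mul, mul_one, card_univ] at h1
  have hf : ((2 * n).factorial : ℝ) ≠ 0 := by positivity
  rw [integral_uniform, sum_labelledRootedMap hn, h1, mul_inv, mul_mul_mul_comm,
    inv_mul_cancel₀ hf, one_mul]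

/-- Averages over the permutations that form a map with a given pairing. -/
theorem abs_sum_pairTransitive_le (hn : 9 ≤ n) {p : Equiv.Perm (Fin (2 * n))}
    (hp : ∀ a, p (p a) = a) (hne : ∀ a, p a ≠ a) {φ : ℝ → ℝ} {B : ℝ} (hB : ∀ x, |φ x| ≤ B)
    (G : Finset (Equiv.Perm (Fin (2 * n)))) (hG : ∀ σ, σ ∈ G ↔ PairTransitive σ p) :
    |∑ σ ∈ G, (φ ((loopEdges p σ).card / n) - ∫ x, φ x ∂loopLaw)| ≤
      2 * (|∑ j ∈ range (n + 1), φ (j / n) *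
        (∫ x, (n.choose j : ℝ) * x ^ j * (1 - x) ^ (n - j) ∂loopLaw) - ∫ x, φ x ∂loopLaw| +
        2 * B * (2 / n + 2 / (n - 1))) * G.card := by
  classical
  set c := ∫ x, φ x ∂loopLaw with hc
  set W : ℝ := ((2 * n).factorial : ℝ) with hW
  set δ : ℝ := 2 / n + 2 / (n - 1) with hδ
  set β := ∑ j ∈ range (n + 1), φ (j / n) *
        (∫ x, (n.choose j : ℝ) * x ^ j * (1 - x) ^ (n - j) ∂loopLaw) - c with hβ
  have hn9 : (9 : ℝ) ≤ n := by exact_mod_cast hn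
  have hW0 : 0 < W := by positivity
  have hB0 : 0 ≤ B := (abs_nonneg _).trans (hB 0)
  have hcB : |c| ≤ B := by
    have := norm_integral_le_of_norm_le_const (μ := loopLaw) (f := φ) (C := B) (.of_forall hB)
    simpa using this
  -- From n = 9 on, 2/9 + 2/8 ≤ 1/2, so at least half of all permutations lie in `G`; this allows
  -- dividing by `G.card`.
  have hδ2 : δ ≤ 1 / 2 := by
    have h1 : (2 : ℝ) / n ≤ 2 / 9 := by gcongr
    have h2 : (2 : ℝ) / (n - 1) ≤ 2 / 8 := by gcongr; linarith
    rw [hδ]; linarith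
  have hδ0 : 0 ≤ δ := by
    have : (0 : ℝ) < n - 1 := by linarith
    positivity
  have hbad : ((Gᶜ).card : ℝ) ≤ W * δ := card_not_pairTransitive_le (by omega) (by simp) hp hne _
    fun σ hσ => fun h => (mem_compl.1 hσ) ((hG σ).2 h)
  have hcardG : (G.card : ℝ) + (Gᶜ).card = W := by
    have := card_add_card_compl G
    rw [Fintype.card_perm, Fintype.card_fin] at this
    rw [hW, ← this]
    push_cast
    ring
  have hall : ∑ σ : Equiv.Perm (Fin (2 * n)), (φ ((loopEdges p σ).card / n) - c) = W * β := by
    rw [sum_sub_distrib, sum_comp_card_loopEdges (n := n) hp hne (by simp) loopLaw loopLaw_compl_Icc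
      integral_pow_loopLaw (fun j => φ (j / n)), sum_const, card_univ, Fintype.card_perm,
      Fintype.card_fin, nsmul_eq_mul, hβ]
    ring
  have hbadsum : |∑ σ ∈ Gᶜ, (φ ((loopEdges p σ).card / n) - c)| ≤ W * δ * (2 * B) := by
    refine (abs_sum_le_sum_abs _ _).trans ((sum_le_card_nsmul _ _ (2 * B) fun σ _ => ?_).trans ?_)
    · exact (abs_sub _ _).trans (by linarith [hB ((loopEdges p σ).card / n)])
    · rw [nsmul_eq_mul]
      exact mul_le_mul_of_nonneg_right hbad (by positivity)
  have hsplit : ∑ σ ∈ G, (φ ((loopEdges p σ).card / n) - c) =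
      W * β - ∑ σ ∈ Gᶜ, (φ ((loopEdges p σ).card / n) - c) := by
    rw [← hall, ← sum_add_sum_compl G]
    ring
  rw [hsplit]
  have hG2 : W ≤ 2 * G.card := by nlinarith
  calc _ ≤ |W * β| + W * δ * (2 * B) := (abs_sub _ _).trans (by linarith)
    _ = W * (|β| + 2 * B * δ) := by rw [abs_mul, abs_of_pos hW0]; ring
    _ ≤ (2 * G.card) * (|β| + 2 * B * δ) := mul_le_mul_of_nonneg_right hG2 (by positivity)
    _ = _ := by ring

/-- Averages over labelled rooted maps. -/
theorem abs_sum_labelledRootedMap_le (hn : 9 ≤ n) {φ : ℝ → ℝ} {B : ℝ} (hB : ∀ x, |φ x| ≤ B) :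
    |∑ M : LabelledRootedMap n, (φ (M.loops.ncard / n) - ∫ x, φ x ∂loopLaw)| ≤
      2 * (|∑ j ∈ range (n + 1), φ (j / n) *
        (∫ x, (n.choose j : ℝ) * x ^ j * (1 - x) ^ (n - j) ∂loopLaw) - ∫ x, φ x ∂loopLaw| +
        2 * B * (2 / n + 2 / (n - 1))) * Fintype.card (LabelledRootedMap n) := by
  classical
  set D := 2 * (|∑ j ∈ range (n + 1), φ (j / n) *
        (∫ x, (n.choose j : ℝ) * x ^ j * (1 - x) ^ (n - j) ∂loopLaw) - ∫ x, φ x ∂loopLaw| +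
        2 * B * (2 / n + 2 / (n - 1))) with hD
  set c := ∫ x, φ x ∂loopLaw with hc
  -- For a fixed pairing and root, a map is the same as a permutation `next` that is transitive
  -- together with the pairing.
  let key : LabelledRootedMap n → Equiv.Perm (Fin (2 * n)) × Option (Fin (2 * n)) :=
    fun M => (M.opp, M.root)
  rw [← card_univ, ← sum_fiberwise univ key, card_eq_sum_card_fiberwise (f := key) (t := univ)
    (fun _ _ => by simp), Nat.cast_sum, mul_sum]
  refine (abs_sum_le_sum_abs _ _).trans (sum_le_sum fun pr _ => ?_)
  by_cases hemp : (univ.filter fun M => key M = pr) = ∅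
  · simp [hemp]
  obtain ⟨M₀, hM₀⟩ := nonempty_iff_ne_empty.2 hemp
  obtain rfl := (mem_filter.1 hM₀).2
  set G := univ.filter fun σ => PairTransitive σ M₀.opp with hG
  have hmem : ∀ M ∈ univ.filter (fun M => key M = key M₀), M.opp = M₀.opp ∧ M.root = M₀.root :=
    fun M hM => Prod.ext_iff.1 (mem_filter.1 hM).2
  have hinto : ∀ M ∈ univ.filter (fun M => key M = key M₀), M.next ∈ G := fun M hM => by
    refine mem_filter.2 ⟨mem_univ _, ?_⟩
    rw [← (hmem M hM).1]
    exact M.connected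
  have hinj : Set.InjOn LabelledRootedMap.next
      ((univ.filter (fun M => key M = key M₀) : Finset (LabelledRootedMap n)) :
        Set (LabelledRootedMap n)) := by
    intro M hM M' hM' h
    have h1 := hmem M hM
    have h2 := hmem M' hM'
    exact LabelledRootedMap.ext h (h1.1.trans h2.1.symm) (h1.2.trans h2.2.symm)
  have hsurj : Set.SurjOn LabelledRootedMap.next
      ((univ.filter (fun M => key M = key M₀) : Finset (LabelledRootedMap n)) :
        Set (LabelledRootedMap n)) G := by
    intro σ hσ
    exact ⟨⟨σ, M₀.opp, M₀.opp_opp, M₀.opp_ne, (mem_filter.1 hσ).2, M₀.root, M₀.root_eq_none⟩,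
      by simp [key], rfl⟩
  rw [card_nbij LabelledRootedMap.next hinto hinj hsurj,
    sum_nbij (g := fun σ => φ ((loopEdges M₀.opp σ).card / n) - c) LabelledRootedMap.next
      hinto hinj hsurj (fun M hM => by rw [M.loops_ncard, (hmem M hM).1])]
  exact abs_sum_pairTransitive_le hn M₀.opp_opp M₀.opp_ne hB G (fun σ => by simp [hG])

/-- Two errors vanish in the limit: that of the Bernstein approximation and the O(1/n) proportion of
disconnected configurations. -/
theorem tendsto_integral_uniform (φ : BoundedContinuousFunction ℝ ℝ) :
    Tendsto (fun n : ℕ => ∫ M, φ ((M.numLoops : ℝ) / n) ∂(RootedMap.uniform n)) atTop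
      (𝓝 (∫ x, φ x ∂loopLaw)) := by
  have hβ := (tendsto_sum_integral_bernstein loopLaw loopLaw_compl_Icc φ.continuous).sub_const
    (∫ x, φ x ∂loopLaw)
  rw [sub_self] at hβ
  have hδ : Tendsto (fun n : ℕ => (2 : ℝ) / n + 2 / (n - 1)) atTop (𝓝 (0 + 0)) := by
    refine Tendsto.add ?_ ?_
    · exact tendsto_const_nhds.div_atTop tendsto_natCast_atTop_atTop
    · exact tendsto_const_nhds.div_atTop
        (tendsto_atTop_add_const_right _ _ tendsto_natCast_atTop_atTop)
  have hlim := ((hβ.abs.add (hδ.const_mul (2 * ‖φ‖))).const_mul 2)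
  simp only [abs_zero, add_zero, mul_zero] at hlim
  rw [tendsto_iff_norm_sub_tendsto_zero]
  refine squeeze_zero' (.of_forall fun _ => norm_nonneg _) ?_ hlim
  filter_upwards [eventually_ge_atTop 9] with n hn
  have h := abs_sum_labelledRootedMap_le hn (φ := φ) (B := ‖φ‖) (fun x => φ.norm_coe_le_norm x)
  have hcard : (0 : ℝ) < Fintype.card (LabelledRootedMap n) := by
    exact_mod_cast Fintype.card_pos
  rw [integral_uniform_numLoops (by omega) (fun k => φ ((k : ℝ) / n))]
  rw [sum_sub_distrib, sum_const, card_univ, nsmul_eq_mul] at h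
  have h2 : (Fintype.card (LabelledRootedMap n) : ℝ)⁻¹ *
      (∑ M : LabelledRootedMap n, φ ((M.loops.ncard : ℝ) / n)) - ∫ x, φ x ∂loopLaw =
      ((∑ M : LabelledRootedMap n, φ ((M.loops.ncard : ℝ) / n)) -
        Fintype.card (LabelledRootedMap n) * ∫ x, φ x ∂loopLaw) /
        Fintype.card (LabelledRootedMap n) := by
    field_simp
  rw [h2, Real.norm_eq_abs, abs_div, abs_of_pos hcard, div_le_iff₀ hcard]
  exact h

end Limit

/-- The number of loops of a uniformly random rooted map with `n` edges, divided by `n`, converges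
in distribution to a law `L` on `[0, 1]` that has a computable density, whose moments are
`η 0 ℓ`, and which is the only law on `[0, 1]` with these moments. -/
theorem mainTheorem3 :
    ∃ (L : Measure ℝ) (_ : IsProbabilityMeasure L),
      TendstoInDistribution
        (fun (n : ℕ) (M : RootedMap n) => (M.numLoops : ℝ) / (n : ℝ)) atTop (id : ℝ → ℝ)
        RootedMap.uniform L ∧
      L (Set.Icc (0 : ℝ) 1)ᶜ = 0 ∧
      (∃ f : ℝ → ℝ, IsComputableDensity f ∧
        L = (volume.restrict (Set.Icc (0 : ℝ) 1)).withDensity (fun x => ENNReal.ofReal (f x))) ∧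
      (∀ l : ℕ, ∫ x, x ^ l ∂L = (loopEta 0 l : ℝ)) ∧
      (∀ L' : Measure ℝ, IsProbabilityMeasure L' → L' (Set.Icc (0 : ℝ) 1)ᶜ = 0 →
        (∀ l : ℕ, ∫ x, x ^ l ∂L' = (loopEta 0 l : ℝ)) → L' = L) := by
  have hmom : ∀ l : ℕ, ∫ x, x ^ l ∂loopLaw = (loopEta 0 l : ℝ) := fun l => by
    rw [integral_pow_loopLaw, loopMoment_zero_left]
  refine ⟨loopLaw, inferInstance, ?_, loopLaw_compl_Icc, exists_isComputableDensity_loopLaw, hmom,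
    fun L' hL' hsupp hL'm => measure_eq_of_moments hsupp loopLaw_compl_Icc fun l => by
      rw [hL'm, hmom]⟩
  have hmeas : ∀ n : ℕ, AEMeasurable (fun M : RootedMap n => (M.numLoops : ℝ) / (n : ℝ))
      (RootedMap.uniform n) := fun n => (measurable_of_finite _).aemeasurable
  refine ⟨hmeas, aemeasurable_id, ?_⟩
  refine ProbabilityMeasure.tendsto_iff_forall_integral_tendsto.2 fun φ => ?_
  have hφ := tendsto_integral_uniform φ
  simp only [ProbabilityMeasure.coe_mk, Measure.map_id]
  refine hφ.congr fun n => ?_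
  rw [integral_map (hmeas n) φ.continuous.aestronglyMeasurable]
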